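/- There are universal constants $C, D > 0$ such that the following holds. Let $\nu$ be a measure on a measurable space $\mathcal X$, let $L \ge 1$, and let $\pi_0, \dots, \pi_L$ be probability densities on $\mathcal X$ with respect to $\nu$, ordered from the hottest level $0$ to the coldest level $L$ (for instance $\pi_i \propto \pi^{\beta_i}$ with $\beta_0 < \dots < \beta_L = 1$); write $\pi_i(A) = \int_A \pi_i \, d\nu$. For each $i$ let $T_i$ be a Markov kernel on $\mathcal X$ that is reversible with respect to $\pi_i$. The parallel tempering chain on $\mathcal X^{L+1}$, reversible with respect to $\pi_0 \otimes \dots \otimes \pi_L$, is $P_{pt} = QTQ$, where * the update move $T$ holds with probability $\frac12$, and otherwise picks $i \in \{0, \dots, L\}$ uniformly and updates $\theta_i$ according to $T_i$; * the swap move $Q$ holds with probability $\frac12$, and otherwise picks $i \in \{1, \dots, L\}$ uniformly and exchanges $\theta_{i-1}$ and $\theta_i$ with probability $\min\{1, \frac{\pi_{i-1}(\theta_i)\pi_i(\theta_{i-1})}{\pi_{i-1}(\theta_{i-1})\pi_i(\theta_i)}\}$, staying put if the exchange is rejected. For a kernel $P$ that is reversible with respect to a probability measure $\mu$, let $\mathrm{Gap}(P)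 = \inf_f \langle f, (I-P)f\rangle_\mu / \mathrm{Var}_\mu(f)$ over all $f \in L^2(\mu)$ with $\mathrm{Var}_\mu(f) > 0$ (and $\mathrm{Gap}(P) = 1$ if there is no such $f$). Let $A_1, \dots, A_m$ be a measurable partition of $\mathcal X$ with $\pi_i(A_k) > 0$ for all $i$ and $k$. Let $T_i|_{A_k}$ be the restricted kernel on $A_k$, $T_i|_{A_k}(\theta, S) = T_i(\theta, S) + \mathbf 1_S(\theta)\, T_i(\theta, A_k^c)$, which is reversible with respect to $\pi_i$ conditioned on $A_k$. Let $\overline T_0$ be the projection of the hottest kernel $T_0$, i.e. the Markov chain on $\{1, \dots, m\}$ with $$\overline T_0(k_1, k_2) = \frac{1}{\pi_0(A_{k_1})}\int_{A_{k_1}} T_0(\theta, A_{k_2})\, \pi_0(d\theta),$$ which is reversible with respect to $k \mapsto \pi_0(A_k)$. Put $$\phi = \min_{|i-j| = 1,\ k} \frac{1}{\pi_i(A_k)} \int_{A_k} \min\{\pi_i, \pi_j\}\, d\nu, \qquad B = \min_k \prod_{i=1}^L \min\Big\{1, \frac{\pi_{i-1}(A_k)}{\pi_i(A_k)}\Big\}.$$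 Then $$\mathrm{Gap}(P_{pt}) \ \ge\ \frac{\phi^2\, B^{\,C \log(L+1)}}{D\, m^3 (L+1)^{3 + 2\log_2 3}} \cdot \mathrm{Gap}(\overline T_0) \cdot \min_{i,k} \mathrm{Gap}(T_i|_{A_k}).$$ -/

import Mathlib

open MeasureTheory ProbabilityTheory

open scoped ENNReal NNReal

noncomputable section

namespace ParallelTempering

/-! ### Spectral gap -/

section Gap

variable {X : Type*} [MeasurableSpace X]

/-- The Dirichlet form `⟨f, (I - P) f⟩_μ` of a kernel `P`. -/
def dirichletForm (P : Kernel X X) (μ : Measure X) (f : X → ℝ) : ℝ :=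
  ∫ x, f x * (f x - ∫ y, f y ∂(P x)) ∂μ

open Classical in
/-- The spectral gap `inf_{f ∈ L²(μ)} ⟨f, (I - P) f⟩_μ / Var_μ(f)`, the infimum being over the
functions of nonzero variance. If there is none (that is, `L²(μ)` only has constants), the gap
is `1` by convention, which is the gap of the chain that draws independent samples from `μ`. -/
def spectralGap (P : Kernel X X) (μ : Measure X) : ℝ :=
  if ∃ f : X → ℝ, MemLp f 2 μ ∧ 0 < variance f μ then
    sInf {r : ℝ | ∃ f : X → ℝ, MemLp f 2 μ ∧ 0 < variance f μ ∧
      r = dirichletForm P μ f / variance f μ}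
  else 1

/-- The restriction of a kernel `P` to a measurable set `A`: the kernel on `A` given by
`P|_A(θ, B) = P(θ, B) + 1_B(θ) P(θ, Aᶜ)`. -/
def restrictTo (P : Kernel X X) (A : Set X) (hA : MeasurableSet A) : Kernel A A where
  toFun θ := (P θ).comap Subtype.val + P θ Aᶜ • Measure.dirac θ
  measurable' := by
    refine Measure.measurable_of_measurable_coe _ fun s hs => ?_
    have h1 : ∀ θ : A, ((P θ).comap Subtype.val + P θ Aᶜ • Measure.dirac θ : Measure A) s
        = P θ (Subtype.val '' s) + P θ Aᶜ * s.indicator 1 θ := by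
      intro θ
      rw [Measure.add_apply, Measure.smul_apply, smul_eq_mul, Measure.dirac_apply' _ hs,
        (MeasurableEmbedding.subtype_coe hA).comap_apply]
    simp_rw [h1]
    exact ((P.measurable_coe (hA.subtype_image hs)).comp measurable_subtype_coe).add
      (((P.measurable_coe hA.compl).comp measurable_subtype_coe).mul
        (measurable_one.indicator hs))

/-- The conditional distribution of `μ` given `A`, as a probability measure on `A`. -/
def condOn (μ : Measure X) (A : Set X) : Measure A :=
  (cond μ A).comap Subtype.val

/-- The projection of a kernel `P` with stationary distribution `μ` onto the index set of a
partition `A`: the Markov chain on `Fin m` with transition matrix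
`P̄(k₁, k₂) = μ(A_{k₁})⁻¹ ∫_{A_{k₁}} P(θ, A_{k₂}) μ(dθ)`. -/
def projKernel (P : Kernel X X) (μ : Measure X) {m : ℕ} (A : Fin m → Set X) :
    Kernel (Fin m) (Fin m) where
  toFun k₁ := ∑ k₂, ((μ (A k₁))⁻¹ * ∫⁻ θ in A k₁, P θ (A k₂) ∂μ) • Measure.dirac k₂
  measurable' := measurable_of_countable _

/-- The projection of a distribution: the mass function `k ↦ μ(A_k)`. -/
def projMeasure (μ : Measure X) {m : ℕ} (A : Fin m → Set X) : Measure (Fin m) :=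
  ∑ k, μ (A k) • Measure.dirac k

end Gap

/-! ### The parallel tempering chain -/

section Chain

variable {X : Type*} [MeasurableSpace X] {L : ℕ}

/-- The distribution on `X` of level `i`, with density `p i` with respect to `ν`. -/
def level (ν : Measure X) (p : Fin (L + 1) → X → ℝ≥0) (i : Fin (L + 1)) : Measure X :=
  ν.withDensity fun x => (p i x : ℝ≥0∞)

/-- The stationary distribution `∏ i, π_i` of the parallel tempering chain. -/
def ptMeasure (ν : Measure X) (p : Fin (L + 1) → X → ℝ≥0)
    [∀ i, IsProbabilityMeasure (level ν p i)] : Measure (Fin (L + 1) → X) :=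
  Measure.pi fun i => level ν p i

/-- The update move `T`: hold with probability `1/2`; otherwise choose a level `i` uniformly
and update the `i`-th coordinate according to `T i`. -/
def updateKernel (T : Fin (L + 1) → Kernel X X) [∀ i, IsMarkovKernel (T i)] :
    Kernel (Fin (L + 1) → X) (Fin (L + 1) → X) where
  toFun θ := (2 : ℝ≥0∞)⁻¹ • Measure.dirac θ +
    (2 * ((L : ℝ≥0∞) + 1))⁻¹ • ∑ i, (T i (θ i)).map (Function.update θ i)
  measurable' := by
    refine Measure.measurable_of_measurable_coe _ fun s hs => ?_
    have h1 : ∀ θ : Fin (L + 1) → X, ((2 : ℝ≥0∞)⁻¹ • Measure.dirac θ +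
        (2 * ((L : ℝ≥0∞) + 1))⁻¹ • ∑ i, (T i (θ i)).map (Function.update θ i)) s
        = 2⁻¹ * s.indicator 1 θ +
          (2 * ((L : ℝ≥0∞) + 1))⁻¹ * ∑ i, T i (θ i) (Function.update θ i ⁻¹' s) := by
      intro θ
      simp only [Measure.add_apply, Measure.smul_apply, smul_eq_mul, Measure.dirac_apply' _ hs,
        Measure.finsetSum_apply]
      congr 2
      exact Finset.sum_congr rfl fun i _ => Measure.map_apply (measurable_update θ) hs
    simp_rw [h1]
    refine ((measurable_one.indicator hs).const_mul _).add (Measurable.const_mul ?_ _)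
    refine Finset.measurable_sum _ fun i _ => ?_
    have h2 : Measurable fun q : (Fin (L + 1) → X) × X => Function.update q.1 i q.2 :=
      measurable_update'
    exact Kernel.measurable_kernel_prodMk_left (κ := (T i).comap (fun θ => θ i)
      (measurable_pi_apply i)) (h2 hs)

/-- Exchange of the coordinates of levels `i` and `i + 1`. -/
def swapLevels (i : Fin L) (θ : Fin (L + 1) → X) : Fin (L + 1) → X :=
  fun j => θ (Equiv.swap i.castSucc i.succ j)

/-- The Metropolis-Hastings probability of accepting the swap of levels `i` and `i + 1`. -/
def swapAccept (p : Fin (L + 1) → X → ℝ≥0) (i : Fin L) (θ : Fin (L + 1) → X) : ℝ≥0 :=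
  min 1 (p i.castSucc (θ i.succ) * p i.succ (θ i.castSucc) /
    (p i.castSucc (θ i.castSucc) * p i.succ (θ i.succ)))

/-- The swap move `Q`: hold with probability `1/2`; otherwise choose a pair of adjacent levels
uniformly, and swap them if the swap is accepted. -/
def swapKernel (p : Fin (L + 1) → X → ℝ≥0) (hp : ∀ i, Measurable (p i)) :
    Kernel (Fin (L + 1) → X) (Fin (L + 1) → X) where
  toFun θ := ∑ i : Fin L, ((2 * (L : ℝ≥0∞))⁻¹ * swapAccept p i θ) • Measure.dirac (swapLevels i θ)
    + (1 - ∑ i : Fin L, (2 * (L : ℝ≥0∞))⁻¹ * swapAccept p i θ) • Measure.dirac θ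
  measurable' := by
    have ha : ∀ i : Fin L, Measurable fun θ : Fin (L + 1) → X =>
        (2 * (L : ℝ≥0∞))⁻¹ * (swapAccept p i θ : ℝ≥0∞) := by
      intro i
      have : Measurable fun θ : Fin (L + 1) → X => swapAccept p i θ := by
        unfold swapAccept
        have := hp i.castSucc
        have := hp i.succ
        fun_prop
      exact this.coe_nnreal_ennreal.const_mul _
    have hsw : ∀ i : Fin L, Measurable (swapLevels (X := X) i) := fun i =>
      measurable_pi_lambda _ fun j => measurable_pi_apply _
    refine Measure.measurable_of_measurable_coe _ fun s hs => ?_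
    simp only [Measure.add_apply, Measure.smul_apply, smul_eq_mul, Measure.dirac_apply' _ hs,
        Measure.finsetSum_apply]
    refine (Finset.measurable_sum _ fun i _ => (ha i).mul ?_).add
      ((measurable_const.sub (Finset.measurable_sum _ fun i _ => ha i)).mul
        (measurable_one.indicator hs))
    exact (measurable_one.indicator hs).comp (hsw i)

/-- The parallel tempering chain `P_pt = Q T Q`. -/
def ptKernel (p : Fin (L + 1) → X → ℝ≥0) (hp : ∀ i, Measurable (p i))
    (T : Fin (L + 1) → Kernel X X) [∀ i, IsMarkovKernel (T i)] :
    Kernel (Fin (L + 1) → X) (Fin (L + 1) → X) :=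
  swapKernel p hp ∘ₖ updateKernel T ∘ₖ swapKernel p hp

/-- The overlap `φ = min_{|i - j| = 1, k} π_i(A_k)⁻¹ ∫_{A_k} min {π_i, π_j} dν`. -/
def overlap (ν : Measure X) (p : Fin (L + 1) → X → ℝ≥0) {m : ℕ} (A : Fin m → Set X) : ℝ :=
  (⨅ (i : Fin (L + 1)) (j : Fin (L + 1)) (_ : (i : ℕ) + 1 = j ∨ (j : ℕ) + 1 = i) (k : Fin m),
    (∫⁻ θ in A k, (min (p i θ) (p j θ) : ℝ≥0) ∂ν) / level ν p i (A k)).toReal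

/-- The bottleneck ratio `B = min_k ∏_{i = 1}^L min {1, π_{i-1}(A_k) / π_i(A_k)}`. -/
def bottleneck (ν : Measure X) (p : Fin (L + 1) → X → ℝ≥0) {m : ℕ} (A : Fin m → Set X) : ℝ :=
  (⨅ k : Fin m, ∏ i : Fin L,
    min 1 (level ν p i.castSucc (A k) / level ν p i.succ (A k))).toReal

end Chain

end ParallelTempering

end

/-!
# A lower bound for the spectral gap of parallel tempering

Both the swap move `Q` and the update move `T` hold with probability at least one half, so
`Q T Q ≥ T / 4` and `Q T Q ≥ Q / 4` as kernels, and the Dirichlet form of the chain dominates those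
of `T` and of `Q` up to a constant. It remains to bound the variance of a bounded measurable
function `f` on `X ^ (L + 1)` by these two forms. All variances and Dirichlet forms are written as
integrals of squared differences with values in `ℝ≥0∞` (`spread`, `energy`), so that the only tools
needed are the triangle inequality for squares, Tonelli's theorem in the form of the invariance of
a product measure under resampling of a coordinate (`lintegral_update`), and the Efron–Stein
inequality (`spread_pi_le`).

*Projection.* Let `F` be the average of `f` given the labels of the blocks that contain the
coordinates. By Efron–Stein within the blocks, the distance of `f` to `F` is controlled by the gaps
of the restricted kernels (`lintegral_sqDist_blockMean_le`, `mul_lintegral_blockLaw_update_le`).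
Up to this distance, the update of the hottest level controls the resampling of the label of level
`0` in `F`, through the gap of the projected chain (`mul_coordSpread_blockMean_le`). The swap
move controls the exchange of adjacent labels in `F`; a swap is accepted with probability at
least `φ ^ 2` given the labels, because `min 1 (a * b) ≥ min 1 a * min 1 b`
(`sq_mul_lintegral_swapLevels_le`).

*The label chain.* By Efron–Stein again, the variance of `F` is bounded by the effects of
resampling the label of each single level `j`. Such a resampling is composed of a resampling at
level `0` and exchanges of the labels of levels `0` and `j` (`sq_mul_coordSpread_le`). An exchange
of distant levels `i < j` is composed of three exchanges between `i`, the midpoint `h` and `j`: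
`(a, x, c) → (x, a, c) → (x, c, a) → (c, x, a)`. A colder level gives a label at most `B⁻¹` times
the mass that a hotter level gives it. So if the two exchanged labels are weighted by the
distribution of the *colder* of their two levels (`swapSpread`), every intermediate configuration
has enough mass, and each halving of the distance costs a factor `9 / B` (`mul_swapSpread_le`).
After `log₂ L` halvings this amounts to a power `2 log₂ 3` of `L` and to a power of `B` of order
`log L` (`pow_mul_swapSpread_le`).
-/

open MeasureTheory ProbabilityTheory

open scoped ENNReal NNReal

noncomputable section

namespace ParallelTempering

/-! ### Squared differences and energies -/

/-- The squared difference of two real numbers, as an extended nonnegative number. -/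
def sqDist (a b : ℝ) : ℝ≥0∞ := ENNReal.ofReal ((a - b) ^ 2)

lemma sqDist_self (a : ℝ) : sqDist a a = 0 := by simp [sqDist]

lemma sqDist_comm (a b : ℝ) : sqDist a b = sqDist b a := by
  unfold sqDist; congr 1; ring

@[fun_prop]
lemma measurable_sqDist {α : Type*} [MeasurableSpace α] {f g : α → ℝ} (hf : Measurable f)
    (hg : Measurable g) : Measurable fun x => sqDist (f x) (g x) := by
  unfold sqDist; fun_prop

/-- The sum of the squares of the diagonals of a quadrilateral is at most that of the sides. -/
lemma sqDist_quadrilateral (a b c d : ℝ) :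
    sqDist a b + sqDist c d ≤ sqDist a c + sqDist b d + sqDist a d + sqDist b c := by
  unfold sqDist
  repeat rw [← ENNReal.ofReal_add (by positivity) (by positivity)]
  exact ENNReal.ofReal_le_ofReal (by nlinarith [sq_nonneg (a + b - c - d)])

lemma sqDist_triangle_two (a b c : ℝ) : sqDist a c ≤ 2 * (sqDist a b + sqDist b c) := by
  unfold sqDist
  rw [show (2 : ℝ≥0∞) = ENNReal.ofReal 2 by simp]
  repeat rw [← ENNReal.ofReal_add (by positivity) (by positivity)]
  rw [← ENNReal.ofReal_mul (by positivity)]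
  exact ENNReal.ofReal_le_ofReal (by nlinarith [sq_nonneg (a - 2 * b + c)])

lemma sqDist_triangle_three (a b c d : ℝ) :
    sqDist a d ≤ 3 * (sqDist a b + sqDist b c + sqDist c d) := by
  unfold sqDist
  rw [show (3 : ℝ≥0∞) = ENNReal.ofReal 3 by simp]
  repeat rw [← ENNReal.ofReal_add (by positivity) (by positivity)]
  rw [← ENNReal.ofReal_mul (by positivity)]
  refine ENNReal.ofReal_le_ofReal ?_
  nlinarith [sq_nonneg ((a - b) - (b - c)), sq_nonneg ((b - c) - (c - d)),
    sq_nonneg ((a - b) - (c - d))]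

lemma sqDist_triangle_five (a b c d e f : ℝ) :
    sqDist a f ≤ 5 * (sqDist a b + sqDist b c + sqDist c d + sqDist d e + sqDist e f) := by
  unfold sqDist
  rw [show (5 : ℝ≥0∞) = ENNReal.ofReal 5 by simp]
  repeat rw [← ENNReal.ofReal_add (by positivity) (by positivity)]
  rw [← ENNReal.ofReal_mul (by positivity)]
  refine ENNReal.ofReal_le_ofReal ?_
  nlinarith [sq_nonneg ((a - b) - (b - c)), sq_nonneg ((a - b) - (c - d)),
    sq_nonneg ((a - b) - (d - e)), sq_nonneg ((a - b) - (e - f)), sq_nonneg ((b - c) - (c - d)),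
    sq_nonneg ((b - c) - (d - e)), sq_nonneg ((b - c) - (e - f)), sq_nonneg ((c - d) - (d - e)),
    sq_nonneg ((c - d) - (e - f)), sq_nonneg ((d - e) - (e - f))]

section Measurability

variable {α β γ : Type*} [MeasurableSpace α] [MeasurableSpace β] [MeasurableSpace γ]

@[fun_prop]
lemma measurable_lintegral_param {ν : Measure β} [SFinite ν] {f : α → β → ℝ≥0∞}
    (hf : Measurable fun z : α × β => f z.1 z.2) : Measurable fun a => ∫⁻ b, f a b ∂ν :=
  hf.lintegral_prod_right'

@[fun_prop]
lemma measurable_lintegral_kernel_param {κ : Kernel γ β} [IsSFiniteKernel κ] {f : α → β → ℝ≥0∞}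
    (hf : Measurable fun z : α × β => f z.1 z.2) {g : α → γ} (hg : Measurable g) :
    Measurable fun a => ∫⁻ b, f a b ∂(κ (g a)) := by
  simpa using Measurable.lintegral_kernel_prod_right' (κ := κ.comap g hg) hf

end Measurability

section Energy

variable {X : Type*} [MeasurableSpace X]

/-- Twice the Dirichlet form of a kernel `P` with stationary distribution `μ`, written as the mean
square increment `∬ (f x - f y)² P(x, dy) μ(dx)` of `f` along one step of the chain. -/
def energy (P : Kernel X X) (μ : Measure X) (f : X → ℝ) : ℝ≥0∞ :=
  ∫⁻ x, ∫⁻ y, sqDist (f x) (f y) ∂(P x) ∂μ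

/-- Twice the variance of `f`, written as `∬ (f x - f y)² μ(dy) μ(dx)`. -/
def spread (μ : Measure X) (f : X → ℝ) : ℝ≥0∞ :=
  ∫⁻ x, ∫⁻ y, sqDist (f x) (f y) ∂μ ∂μ

lemma lintegral_lintegral_of_invariant {P : Kernel X X} {μ : Measure X} (h : P.Invariant μ)
    {g : X → ℝ≥0∞} (hg : Measurable g) : ∫⁻ x, ∫⁻ y, g y ∂(P x) ∂μ = ∫⁻ x, g x ∂μ := by
  conv_rhs => rw [← h.def]
  rw [Measure.lintegral_bind (Kernel.aemeasurable _) hg.aemeasurable]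

lemma ae_ae_of_invariant {P : Kernel X X} {μ : Measure X} (h : P.Invariant μ)
    {p : X → Prop} (hp : ∀ᵐ x ∂μ, p x) : ∀ᵐ x ∂μ, ∀ᵐ y ∂(P x), p y := by
  rw [← h.def] at hp
  exact Measure.ae_ae_of_ae_bind (Kernel.aemeasurable _) hp

/-- Invariance makes the Dirichlet form independent of the values of `f` on null sets. -/
lemma dirichletForm_congr {P : Kernel X X} {μ : Measure X} (h : P.Invariant μ) {f g : X → ℝ}
    (hfg : f =ᵐ[μ] g) : dirichletForm P μ f = dirichletForm P μ g := by
  refine integral_congr_ae ?_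
  filter_upwards [hfg, ae_ae_of_invariant h hfg] with x hx hy
  rw [hx, integral_congr_ae hy]

lemma two_mul_dirichletForm {P : Kernel X X} [IsMarkovKernel P] {μ : Measure X}
    [IsProbabilityMeasure μ] (h : P.Invariant μ) {f : X → ℝ} (hm : Measurable f)
    (hf : MemLp f 2 μ) :
    Integrable (fun z : X × X => (f z.1 - f z.2) ^ 2) (μ ⊗ₘ P) ∧
      2 * dirichletForm P μ f = ∫ z, (f z.1 - f z.2) ^ 2 ∂(μ ⊗ₘ P) := by
  have hfst : (μ ⊗ₘ P).map Prod.fst = μ := Measure.fst_compProd μ P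
  have hsnd : (μ ⊗ₘ P).map Prod.snd = μ := (Measure.snd_compProd μ P).trans h.def
  have h1 : MemLp (fun z : X × X => f z.1) 2 (μ ⊗ₘ P) :=
    MemLp.comp_of_map (hfst.symm ▸ hf) measurable_fst.aemeasurable
  have h2 : MemLp (fun z : X × X => f z.2) 2 (μ ⊗ₘ P) :=
    MemLp.comp_of_map (hsnd.symm ▸ hf) measurable_snd.aemeasurable
  have i12 : Integrable (fun z : X × X => f z.1 * f z.2) (μ ⊗ₘ P) := h1.integrable_mul h2
  have i1 := h1.integrable_sq
  have i2 := h2.integrable_sq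
  have e1 : ∫ z, f z.1 ^ 2 ∂(μ ⊗ₘ P) = ∫ x, f x ^ 2 ∂μ := by
    conv_rhs => rw [← hfst]
    rw [integral_map measurable_fst.aemeasurable (by fun_prop)]
  have e2 : ∫ z, f z.2 ^ 2 ∂(μ ⊗ₘ P) = ∫ x, f x ^ 2 ∂μ := by
    conv_rhs => rw [← hsnd]
    rw [integral_map measurable_snd.aemeasurable (by fun_prop)]
  have e12 : ∫ z, f z.1 * f z.2 ∂(μ ⊗ₘ P) = ∫ x, f x * ∫ y, f y ∂(P x) ∂μ := by
    rw [Measure.integral_compProd i12]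
    simp_rw [integral_const_mul]
  have j12 : Integrable (fun x => f x * ∫ y, f y ∂(P x)) μ := by
    have := Measure.integrable_compProd_iff i12.1 |>.1 i12
    refine (this.2.mono' ?_ ?_)
    · have hP : StronglyMeasurable fun x => ∫ y, f y ∂(P x) :=
        hm.stronglyMeasurable.integral_kernel
      exact (hm.stronglyMeasurable.mul hP).aestronglyMeasurable
    · refine Filter.Eventually.of_forall fun x => ?_
      rw [← integral_const_mul]
      exact norm_integral_le_integral_norm _
  have e3 : dirichletForm P μ f = ∫ x, f x ^ 2 ∂μ - ∫ x, f x * ∫ y, f y ∂(P x) ∂μ := by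
    unfold dirichletForm
    rw [← integral_sub hf.integrable_sq j12]
    congr 1; ext x; ring
  refine ⟨(h1.sub h2).integrable_sq, ?_⟩
  have : ∀ z : X × X, (f z.1 - f z.2) ^ 2
      = f z.1 ^ 2 + f z.2 ^ 2 - 2 * (f z.1 * f z.2) := fun z => by ring
  simp_rw [this]
  rw [integral_sub (by exact i1.add i2) (i12.const_mul 2), integral_add i1 i2, integral_const_mul,
    e1, e2, e12, e3]
  ring

lemma ofReal_two_mul_dirichletForm {P : Kernel X X} [IsMarkovKernel P] {μ : Measure X}
    [IsProbabilityMeasure μ] (h : P.Invariant μ) {f : X → ℝ} (hm : Measurable f)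
    (hf : MemLp f 2 μ) : ENNReal.ofReal (2 * dirichletForm P μ f) = energy P μ f := by
  obtain ⟨hi, he⟩ := two_mul_dirichletForm h hm hf
  rw [he, ofReal_integral_eq_lintegral_ofReal hi (Filter.Eventually.of_forall fun z => sq_nonneg _),
    Measure.lintegral_compProd (by fun_prop)]
  rfl

lemma dirichletForm_nonneg {P : Kernel X X} [IsMarkovKernel P] {μ : Measure X}
    [IsProbabilityMeasure μ] (h : P.Invariant μ) {f : X → ℝ} (hf : MemLp f 2 μ) :
    0 ≤ dirichletForm P μ f := by
  obtain ⟨g, hg, hfg⟩ := hf.1.aemeasurable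
  have := (two_mul_dirichletForm h hg (hf.ae_eq hfg)).2
  have h0 : 0 ≤ ∫ z, (g z.1 - g z.2) ^ 2 ∂(μ ⊗ₘ P) := integral_nonneg fun z => sq_nonneg _
  rw [dirichletForm_congr h hfg]
  linarith

lemma invariant_const (μ : Measure X) [IsProbabilityMeasure μ] :
    (Kernel.const X μ).Invariant μ := by
  unfold Kernel.Invariant
  simp

lemma ofReal_two_mul_variance {μ : Measure X} [IsProbabilityMeasure μ] {f : X → ℝ}
    (hm : Measurable f) (hf : MemLp f 2 μ) : ENNReal.ofReal (2 * variance f μ) = spread μ f := by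
  have := ofReal_two_mul_dirichletForm (invariant_const μ) hm hf
  rw [show spread μ f = energy (Kernel.const X μ) μ f from rfl, ← this]
  congr 2
  unfold dirichletForm
  have hi : Integrable f μ := hf.integrable (by norm_num)
  simp only [Kernel.const_apply]
  have : ∀ x, f x * (f x - ∫ y, f y ∂μ) = f x ^ 2 - f x * ∫ y, f y ∂μ := fun x => by ring
  simp_rw [this]
  rw [integral_sub hf.integrable_sq (hi.mul_const _), integral_mul_const, variance_eq_sub hf]
  simp [sq]

lemma bddBelow_rayleigh {P : Kernel X X} [IsMarkovKernel P] {μ : Measure X}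
    [IsProbabilityMeasure μ] (h : P.Invariant μ) :
    BddBelow {r : ℝ | ∃ f : X → ℝ, MemLp f 2 μ ∧ 0 < variance f μ ∧
      r = dirichletForm P μ f / variance f μ} := by
  refine ⟨0, ?_⟩
  rintro r ⟨f, hf, hv, rfl⟩
  exact div_nonneg (dirichletForm_nonneg h hf) hv.le

lemma spectralGap_nonneg {P : Kernel X X} [IsMarkovKernel P] {μ : Measure X}
    [IsProbabilityMeasure μ] (h : P.Invariant μ) : 0 ≤ spectralGap P μ := by
  unfold spectralGap
  split_ifs
  · refine Real.sInf_nonneg ?_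
    rintro r ⟨f, hf, hv, rfl⟩
    exact div_nonneg (dirichletForm_nonneg h hf) hv.le
  · norm_num

lemma spectralGap_mul_variance_le {P : Kernel X X} [IsMarkovKernel P] {μ : Measure X}
    [IsProbabilityMeasure μ] (h : P.Invariant μ) {f : X → ℝ} (hf : MemLp f 2 μ) :
    spectralGap P μ * variance f μ ≤ dirichletForm P μ f := by
  rcases (variance_nonneg f μ).eq_or_lt with h0 | hv
  · rw [← h0, mul_zero]
    exact dirichletForm_nonneg h hf
  · rw [← le_div_iff₀ hv]
    unfold spectralGap
    rw [if_pos ⟨f, hf, hv⟩]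
    exact csInf_le (bddBelow_rayleigh h) ⟨f, hf, hv, rfl⟩

/-- The Poincaré inequality that defines the spectral gap, for mean square increments. -/
lemma ofReal_spectralGap_mul_spread_le {P : Kernel X X} [IsMarkovKernel P] {μ : Measure X}
    [IsProbabilityMeasure μ] (h : P.Invariant μ) {f : X → ℝ} (hm : Measurable f)
    (hf : MemLp f 2 μ) : ENNReal.ofReal (spectralGap P μ) * spread μ f ≤ energy P μ f := by
  rw [← ofReal_two_mul_variance hm hf, ← ofReal_two_mul_dirichletForm h hm hf,
    ← ENNReal.ofReal_mul (spectralGap_nonneg h)]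
  refine ENNReal.ofReal_le_ofReal ?_
  linarith [spectralGap_mul_variance_le h hf]

lemma energy_le_four_mul_spread {P : Kernel X X} [IsMarkovKernel P] {μ : Measure X}
    [IsProbabilityMeasure μ] (h : P.Invariant μ) {f : X → ℝ} (hm : Measurable f) :
    energy P μ f ≤ 4 * spread μ f := by
  have h1 : ∀ z, energy P μ f ≤ 2 * (∫⁻ x, sqDist (f x) (f z) ∂μ
      + ∫⁻ x, sqDist (f z) (f x) ∂μ) := by
    intro z
    calc energy P μ f ≤ ∫⁻ x, ∫⁻ y, 2 * (sqDist (f x) (f z) + sqDist (f z) (f y)) ∂(P x) ∂μ :=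
          lintegral_mono fun x => lintegral_mono fun y => sqDist_triangle_two _ _ _
      _ = 2 * (∫⁻ x, sqDist (f x) (f z) ∂μ + ∫⁻ x, ∫⁻ y, sqDist (f z) (f y) ∂(P x) ∂μ) := by
          rw [← lintegral_add_left (by fun_prop), ← lintegral_const_mul']
          · refine lintegral_congr fun x => ?_
            rw [lintegral_const_mul' _ _ (by simp), lintegral_add_left (by fun_prop)]
            simp
          · simp
      _ = _ := by rw [lintegral_lintegral_of_invariant h (by fun_prop)]
  have h2 : ∀ z, energy P μ f ≤ 4 * ∫⁻ x, sqDist (f z) (f x) ∂μ := by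
    intro z
    refine (h1 z).trans_eq ?_
    simp_rw [sqDist_comm _ (f z)]
    ring
  calc energy P μ f = ∫⁻ _, energy P μ f ∂μ := by simp
    _ ≤ ∫⁻ z, 4 * ∫⁻ x, sqDist (f z) (f x) ∂μ ∂μ := lintegral_mono h2
    _ = 4 * spread μ f := lintegral_const_mul' _ _ (by simp)

/-- The sharp constant is `2`; any absolute bound will do. -/
lemma spectralGap_le_four {P : Kernel X X} [IsMarkovKernel P] {μ : Measure X}
    [IsProbabilityMeasure μ] (h : P.Invariant μ) : spectralGap P μ ≤ 4 := by
  by_cases hex : ∃ f : X → ℝ, MemLp f 2 μ ∧ 0 < variance f μ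
  · obtain ⟨f, hf, hv⟩ := hex
    obtain ⟨g, hg, hfg⟩ := hf.1.aemeasurable
    have hg2 := hf.ae_eq hfg
    rw [variance_congr hfg] at hv
    have h1 := spectralGap_mul_variance_le h hg2
    have h2 := energy_le_four_mul_spread h hg
    rw [← ofReal_two_mul_variance hg hg2, ← ofReal_two_mul_dirichletForm h hg hg2,
      show (4 : ℝ≥0∞) = ENNReal.ofReal 4 by simp, ← ENNReal.ofReal_mul (by norm_num),
      ENNReal.ofReal_le_ofReal_iff (by positivity)] at h2
    have h3 : spectralGap P μ * variance g μ ≤ 4 * variance g μ := by linarith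
    exact le_of_mul_le_mul_right h3 hv
  · unfold spectralGap
    rw [if_neg hex]
    norm_num

/-- Truncation of a real number to `[-n, n]`. -/
def clamp (n : ℕ) (a : ℝ) : ℝ := max (-n) (min n a)

lemma abs_clamp_le (n : ℕ) (a : ℝ) : |clamp n a| ≤ n := by
  have : (0 : ℝ) ≤ n := n.cast_nonneg
  unfold clamp
  rw [abs_le]
  exact ⟨le_max_left _ _, max_le (by linarith) (min_le_left _ _)⟩

lemma measurable_clamp (n : ℕ) : Measurable (clamp n) := by
  unfold clamp; fun_prop

lemma abs_clamp_sub_clamp_le (n : ℕ) (a b : ℝ) : |clamp n a - clamp n b| ≤ |a - b| := by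
  unfold clamp
  calc _ ≤ |min (n : ℝ) a - min (n : ℝ) b| := by
        simpa using abs_max_sub_max_le_max (-n : ℝ) (min n a) (-n) (min n b)
    _ ≤ |a - b| := by simpa using abs_min_sub_min_le_max (n : ℝ) a (n : ℝ) b

lemma clamp_clamp {n k : ℕ} (h : n ≤ k) (a : ℝ) : clamp n (clamp k a) = clamp n a := by
  have h1 : (n : ℝ) ≤ k := by exact_mod_cast h
  have h0 : (0 : ℝ) ≤ n := n.cast_nonneg
  unfold clamp
  grind

lemma clamp_of_abs_le {n : ℕ} {a : ℝ} (h : |a| ≤ n) : clamp n a = a := by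
  rw [abs_le] at h
  unfold clamp
  rw [min_eq_right h.2, max_eq_right h.1]

lemma sqDist_clamp_le (n : ℕ) (a b : ℝ) : sqDist (clamp n a) (clamp n b) ≤ sqDist a b :=
  ENNReal.ofReal_le_ofReal (sq_le_sq.2 (abs_clamp_sub_clamp_le n a b))

lemma iSup_sqDist_clamp (a b : ℝ) : ⨆ n, sqDist (clamp n a) (clamp n b) = sqDist a b := by
  refine le_antisymm (iSup_le fun n => sqDist_clamp_le n a b) ?_
  obtain ⟨n, hn⟩ := exists_nat_ge (max |a| |b|)
  refine le_iSup_of_le n ?_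
  rw [clamp_of_abs_le ((le_max_left _ _).trans hn), clamp_of_abs_le ((le_max_right _ _).trans hn)]

lemma iSup_spread_clamp {μ : Measure X} [SFinite μ] {f : X → ℝ} (hm : Measurable f) :
    ⨆ n, spread μ (fun x => clamp n (f x)) = spread μ f := by
  have key : ∀ g : X → ℝ, Measurable g →
      spread μ g = ∫⁻ z, sqDist (g z.1) (g z.2) ∂(μ.prod μ) := by
    intro g hg
    rw [lintegral_prod _ (by fun_prop)]
    rfl
  rw [key f hm]
  have key' : ∀ n, spread μ (fun x => clamp n (f x))
      = ∫⁻ z, sqDist (clamp n (f z.1)) (clamp n (f z.2)) ∂(μ.prod μ) := fun n =>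
    key _ ((measurable_clamp n).comp hm)
  simp_rw [key', ← iSup_sqDist_clamp (f (Prod.fst _)) (f (Prod.snd _))]
  refine (lintegral_iSup ?_ ?_).symm
  · intro n
    have := measurable_clamp n
    fun_prop
  · intro n k hnk z
    dsimp only
    rw [← clamp_clamp hnk (f z.1), ← clamp_clamp hnk (f z.2)]
    exact sqDist_clamp_le _ _ _

/-- A Poincaré inequality for bounded measurable functions bounds the spectral gap from below:
both sides are monotone under truncation. The bound `c ≤ 1` is for the case that all functions in
`L²(μ)` are constant. -/
lemma le_spectralGap {P : Kernel X X} [IsMarkovKernel P] {μ : Measure X}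
    [IsProbabilityMeasure μ] (h : P.Invariant μ) {c : ℝ} (hc0 : 0 ≤ c) (hc : c ≤ 1)
    (H : ∀ f : X → ℝ, Measurable f → (∃ M, ∀ x, |f x| ≤ M) →
      ENNReal.ofReal c * spread μ f ≤ energy P μ f) : c ≤ spectralGap P μ := by
  unfold spectralGap
  split_ifs with hex
  · obtain ⟨f, hf, hv⟩ := hex
    refine le_csInf ⟨_, f, hf, hv, rfl⟩ ?_
    clear! f
    rintro r ⟨f, hf, hv, rfl⟩
    obtain ⟨g, hg, hfg⟩ := hf.1.aemeasurable
    have hg2 := hf.ae_eq hfg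
    rw [variance_congr hfg] at hv ⊢
    rw [dirichletForm_congr h hfg, le_div_iff₀ hv]
    have h1 : ENNReal.ofReal c * spread μ g ≤ energy P μ g := by
      rw [← iSup_spread_clamp hg, ENNReal.mul_iSup]
      refine iSup_le fun n => (H _ ((measurable_clamp n).comp hg)
        ⟨n, fun x => abs_clamp_le _ _⟩).trans ?_
      exact lintegral_mono fun x => lintegral_mono fun y => sqDist_clamp_le _ _ _
    rw [← ofReal_two_mul_variance hg hg2, ← ofReal_two_mul_dirichletForm h hg hg2,
      ← ENNReal.ofReal_mul hc0, ENNReal.ofReal_le_ofReal_iff] at h1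
    · linarith
    · have := dirichletForm_nonneg h hg2
      positivity
  · exact hc

end Energy

/-! ### Product measures and the Efron–Stein inequality -/

section Product

variable {ι Y : Type*} [Fintype ι] [DecidableEq ι] [MeasurableSpace Y] (π : ι → Measure Y)
  [∀ i, IsProbabilityMeasure (π i)]

/-- Resampling one coordinate leaves a product measure invariant. -/
lemma lintegral_update (i : ι) {G : (ι → Y) → ℝ≥0∞} (hG : Measurable G) :
    ∫⁻ θ, ∫⁻ x, G (Function.update θ i x) ∂(π i) ∂(Measure.pi π) = ∫⁻ θ, G θ ∂(Measure.pi π) := by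
  have hu : Measurable fun z : (ι → Y) × Y => Function.update z.1 i z.2 := measurable_update'
  have : ((Measure.pi π).prod (π i)).map (fun z => Function.update z.1 i z.2)
      = Measure.pi π := by
    refine (Measure.pi_eq fun s hs => ?_).symm
    rw [Measure.map_apply hu (MeasurableSet.univ_pi hs)]
    have : (fun z : (ι → Y) × Y => Function.update z.1 i z.2) ⁻¹' Set.univ.pi s
        = (Set.univ.pi (Function.update s i Set.univ)) ×ˢ (s i) := by
      ext ⟨θ, x⟩
      simp only [Set.mem_preimage, Set.mem_univ_pi, Set.mem_prod]
      constructor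
      · intro h
        refine ⟨fun j => ?_, by simpa using h i⟩
        by_cases hj : j = i
        · subst hj; simp
        · simpa [hj] using h j
      · rintro ⟨h, hx⟩ j
        by_cases hj : j = i
        · subst hj; simpa using hx
        · simpa [hj] using h j
    rw [this, Measure.prod_prod, Measure.pi_pi]
    have h2 : ∀ j, π j (Function.update s i Set.univ j)
        = Function.update (fun j => π j (s j)) i 1 j := by
      intro j
      by_cases hj : j = i
      · subst hj; simp
      · simp [hj]
    simp_rw [h2]
    rw [Finset.prod_update_of_mem (Finset.mem_univ i), one_mul, mul_comm,
      ← Finset.erase_eq, Finset.mul_prod_erase _ (fun j => π j (s j)) (Finset.mem_univ i)]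
  conv_rhs => rw [← this]
  rw [lintegral_map hG hu, lintegral_prod _ (by exact (hG.comp hu).aemeasurable)]

omit [Fintype ι] in
@[fun_prop]
lemma measurable_update_param {α : Type*} [MeasurableSpace α] (i : ι) {g : α → ι → Y} {h : α → Y}
    (hg : Measurable g) (hh : Measurable h) :
    Measurable fun a => Function.update (g a) i (h a) :=
  measurable_update'.comp (hg.prodMk hh)

/-- Exchanging one coordinate between two independent samples of a product measure. -/
lemma lintegral_exchange_one (i : ι) {G : (ι → Y) → (ι → Y) → ℝ≥0∞}
    (hG : Measurable fun z : (ι → Y) × (ι → Y) => G z.1 z.2) :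
    ∫⁻ θ, ∫⁻ η, G (Function.update θ i (η i)) (Function.update η i (θ i))
      ∂(Measure.pi π) ∂(Measure.pi π) = ∫⁻ θ, ∫⁻ η, G θ η ∂(Measure.pi π) ∂(Measure.pi π) := by
  have key : ∀ H : (ι → Y) → (ι → Y) → ℝ≥0∞,
      Measurable (fun z : (ι → Y) × (ι → Y) => H z.1 z.2) →
      ∫⁻ θ, ∫⁻ η, H θ η ∂(Measure.pi π) ∂(Measure.pi π)
        = ∫⁻ θ, ∫⁻ η, ∫⁻ x, ∫⁻ y, H (Function.update θ i x) (Function.update η i y)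
          ∂(π i) ∂(π i) ∂(Measure.pi π) ∂(Measure.pi π) := by
    intro H hH
    rw [← lintegral_update π i (by fun_prop)]
    refine lintegral_congr fun θ => ?_
    rw [lintegral_lintegral_swap (by fun_prop)]
    have : ∀ x, ∫⁻ η, H (Function.update θ i x) η ∂(Measure.pi π) =
        ∫⁻ η, ∫⁻ y, H (Function.update θ i x) (Function.update η i y) ∂(π i) ∂(Measure.pi π) :=
      fun x => (lintegral_update π i (by fun_prop)).symm
    rw [lintegral_lintegral_swap (by fun_prop)]
    simp_rw [this]
    rw [lintegral_lintegral_swap (by fun_prop)]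
  rw [key G hG, key _ (by fun_prop)]
  refine lintegral_congr fun θ => lintegral_congr fun η => ?_
  rw [lintegral_lintegral_swap (by fun_prop)]
  simp

omit [Fintype ι] in
@[fun_prop]
lemma measurable_piecewise_param {α : Type*} [MeasurableSpace α] (S : Finset ι) {g h : α → ι → Y}
    (hg : Measurable g) (hh : Measurable h) :
    Measurable fun a => S.piecewise (g a) (h a) := by
  refine measurable_pi_lambda _ fun i => ?_
  by_cases hi : i ∈ S
  · simp only [hi, Finset.piecewise_eq_of_mem]; fun_prop
  · simp only [hi, not_false_eq_true, Finset.piecewise_eq_of_notMem]; fun_prop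

/-- Exchanging a set of coordinates between two independent samples of a product measure. -/
lemma lintegral_exchange (S : Finset ι) {G : (ι → Y) → (ι → Y) → ℝ≥0∞}
    (hG : Measurable fun z : (ι → Y) × (ι → Y) => G z.1 z.2) :
    ∫⁻ θ, ∫⁻ η, G (S.piecewise η θ) (S.piecewise θ η)
      ∂(Measure.pi π) ∂(Measure.pi π) = ∫⁻ θ, ∫⁻ η, G θ η ∂(Measure.pi π) ∂(Measure.pi π) := by
  induction S using Finset.induction_on generalizing G with
  | empty => simp
  | insert i S hi ih =>
    rw [← ih hG, ← lintegral_exchange_one π i (by fun_prop)]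
    refine lintegral_congr fun θ => lintegral_congr fun η => ?_
    congr 1 <;>
    · ext j
      by_cases hj : j = i
      · subst hj; simp [hi]
      · by_cases hjS : j ∈ S <;> simp [hj, hjS]

/-- The mean square effect of resampling the `i`-th coordinate. -/
def coordSpread (i : ι) (f : (ι → Y) → ℝ) : ℝ≥0∞ :=
  ∫⁻ θ, ∫⁻ x, sqDist (f θ) (f (Function.update θ i x)) ∂(π i) ∂(Measure.pi π)

/-- The Efron–Stein inequality for the coordinates in `S`: a coordinate is added by applying the
quadrilateral inequality to the values of `f` after resampling none, one, the other or both of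
`i` and `S`. -/
lemma lintegral_sqDist_piecewise_le (S : Finset ι) {f : (ι → Y) → ℝ} (hf : Measurable f) :
    ∫⁻ θ, ∫⁻ η, sqDist (f θ) (f (S.piecewise η θ)) ∂(Measure.pi π) ∂(Measure.pi π)
      ≤ ∑ i ∈ S, coordSpread π i f := by
  induction S using Finset.induction_on with
  | empty => simp [sqDist_self]
  | insert i S hi ih =>
    rw [Finset.sum_insert hi]
    -- the four values are `f θ`, `f (u θ η)`, `f (v θ η)`, `f (w θ η)`
    let u : (ι → Y) → (ι → Y) → (ι → Y) := fun θ η => (insert i S).piecewise η θ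
    let v : (ι → Y) → (ι → Y) → (ι → Y) := fun θ η => Function.update θ i (η i)
    let w : (ι → Y) → (ι → Y) → (ι → Y) := fun θ η => S.piecewise η θ
    let μ := Measure.pi π
    have hcd : ∫⁻ θ, ∫⁻ η, sqDist (f (v θ η)) (f (w θ η)) ∂μ ∂μ
        = ∫⁻ θ, ∫⁻ η, sqDist (f θ) (f (u θ η)) ∂μ ∂μ := by
      rw [← lintegral_exchange_one π i (by fun_prop)]
      refine lintegral_congr fun θ => lintegral_congr fun η => ?_
      congr 2
      · simp [v]
      · ext j
        by_cases hj : j = i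
        · subst hj; simp [u, w, hi]
        · by_cases hjS : j ∈ S <;> simp [u, w, hj, hjS]
    have hbd : ∫⁻ θ, ∫⁻ η, sqDist (f (u θ η)) (f (w θ η)) ∂μ ∂μ
        = ∫⁻ θ, ∫⁻ η, sqDist (f θ) (f (v θ η)) ∂μ ∂μ := by
      rw [← lintegral_exchange π S (by fun_prop)]
      refine lintegral_congr fun θ => lintegral_congr fun η => ?_
      rw [sqDist_comm]
      congr 2
      · ext j
        by_cases hjS : j ∈ S <;> simp [w, hjS]
      · ext j
        by_cases hj : j = i
        · subst hj; simp [u, v, hi]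
        · by_cases hjS : j ∈ S <;> simp [u, v, hj, hjS]
    have hbc : ∫⁻ θ, ∫⁻ η, sqDist (f (u θ η)) (f (v θ η)) ∂μ ∂μ
        = ∫⁻ θ, ∫⁻ η, sqDist (f θ) (f (w θ η)) ∂μ ∂μ := by
      rw [← lintegral_exchange_one π i (by fun_prop)]
      refine lintegral_congr fun θ => lintegral_congr fun η => ?_
      rw [sqDist_comm]
      congr 2
      · simp [v]
      · ext j
        by_cases hj : j = i
        · subst hj; simp [u, w, hi]
        · by_cases hjS : j ∈ S <;> simp [u, w, hj, hjS]
    have hac : ∫⁻ θ, ∫⁻ η, sqDist (f θ) (f (v θ η)) ∂μ ∂μ = coordSpread π i f := by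
      refine lintegral_congr fun θ => ?_
      exact lintegral_map (μ := μ) (g := fun η => η i)
        (f := fun x => sqDist (f θ) (f (Function.update θ i x))) (by fun_prop) (by fun_prop)
        |>.symm.trans (by rw [(measurePreserving_eval π i).map_eq])
    have quad : ∫⁻ θ, ∫⁻ η, (sqDist (f θ) (f (u θ η)) + sqDist (f (v θ η)) (f (w θ η))) ∂μ ∂μ
        ≤ ∫⁻ θ, ∫⁻ η, (sqDist (f θ) (f (v θ η)) + sqDist (f (u θ η)) (f (w θ η))
          + sqDist (f θ) (f (w θ η)) + sqDist (f (u θ η)) (f (v θ η))) ∂μ ∂μ :=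
      lintegral_mono fun θ => lintegral_mono fun η => sqDist_quadrilateral _ _ _ _
    have split : ∀ {G H : (ι → Y) → (ι → Y) → ℝ≥0∞},
        Measurable (fun z : (ι → Y) × (ι → Y) => G z.1 z.2) →
        ∫⁻ θ, ∫⁻ η, (G θ η + H θ η) ∂μ ∂μ
          = ∫⁻ θ, ∫⁻ η, G θ η ∂μ ∂μ + ∫⁻ θ, ∫⁻ η, H θ η ∂μ ∂μ := by
      intro G H hG
      rw [← lintegral_add_left (by fun_prop)]
      exact lintegral_congr fun θ => lintegral_add_left (by fun_prop) _
    rw [split (by fun_prop), split (by fun_prop), split (by fun_prop), split (by fun_prop),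
      hcd, hbd, hbc, hac] at quad
    have h2 : 2 * ∫⁻ θ, ∫⁻ η, sqDist (f θ) (f (u θ η)) ∂μ ∂μ
        ≤ 2 * (coordSpread π i f + ∫⁻ θ, ∫⁻ η, sqDist (f θ) (f (w θ η)) ∂μ ∂μ) := by
      refine le_of_eq_of_le (two_mul _) (quad.trans_eq ?_)
      ring
    refine ((ENNReal.mul_le_mul_iff_right (by norm_num) (by norm_num)).1 h2).trans ?_
    gcongr

/-- The Efron–Stein inequality. -/
lemma spread_pi_le {f : (ι → Y) → ℝ} (hf : Measurable f) :
    spread (Measure.pi π) f ≤ ∑ i, coordSpread π i f := by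
  simpa [spread] using lintegral_sqDist_piecewise_le π Finset.univ hf

end Product

/-! ### Exchanging distant levels -/

section Triple

variable {Y : Type*} [MeasurableSpace Y]

/-- Integral over three independent variables. -/
def tripleIntegral (μ₁ μ₂ μ₃ : Measure Y) (T : Y → Y → Y → ℝ≥0∞) : ℝ≥0∞ :=
  ∫⁻ x, ∫⁻ y, ∫⁻ z, T x y z ∂μ₃ ∂μ₂ ∂μ₁

variable {μ₁ μ₂ μ₃ ν : Measure Y} {S T : Y → Y → Y → ℝ≥0∞}

lemma tripleIntegral_mono (h : ∀ x y z, S x y z ≤ T x y z) :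
    tripleIntegral μ₁ μ₂ μ₃ S ≤ tripleIntegral μ₁ μ₂ μ₃ T :=
  lintegral_mono fun x => lintegral_mono fun y => lintegral_mono fun z => h x y z

lemma tripleIntegral_const_mul {c : ℝ≥0∞} (hc : c ≠ ∞) :
    tripleIntegral μ₁ μ₂ μ₃ (fun x y z => c * T x y z) = c * tripleIntegral μ₁ μ₂ μ₃ T := by
  simp only [tripleIntegral, lintegral_const_mul' _ _ hc]

lemma tripleIntegral_add [SFinite μ₁] [SFinite μ₂] [SFinite μ₃]
    (hS : Measurable fun z : Y × Y × Y => S z.1 z.2.1 z.2.2) :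
    tripleIntegral μ₁ μ₂ μ₃ (fun x y z => S x y z + T x y z)
      = tripleIntegral μ₁ μ₂ μ₃ S + tripleIntegral μ₁ μ₂ μ₃ T := by
  unfold tripleIntegral
  rw [← lintegral_add_left (by fun_prop)]
  refine lintegral_congr fun x => ?_
  rw [← lintegral_add_left (by fun_prop)]
  refine lintegral_congr fun y => ?_
  rw [← lintegral_add_left (by fun_prop)]

lemma tripleIntegral_swap_left [SFinite μ₁] [SFinite μ₂] [SFinite μ₃]
    (hT : Measurable fun z : Y × Y × Y => T z.1 z.2.1 z.2.2) :
    tripleIntegral μ₁ μ₂ μ₃ T = tripleIntegral μ₂ μ₁ μ₃ (fun x y z => T y x z) :=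
  lintegral_lintegral_swap (by fun_prop)

lemma tripleIntegral_swap_right [SFinite μ₂] [SFinite μ₃]
    (hT : Measurable fun z : Y × Y × Y => T z.1 z.2.1 z.2.2) :
    tripleIntegral μ₁ μ₂ μ₃ T = tripleIntegral μ₁ μ₃ μ₂ (fun x y z => T x z y) :=
  lintegral_congr fun _ => lintegral_lintegral_swap (by fun_prop)

lemma mul_lintegral_le_of_smul_le {c : ℝ≥0∞} {μ ν : Measure Y} (h : c • μ ≤ ν) (g : Y → ℝ≥0∞) :
    c * ∫⁻ x, g x ∂μ ≤ ∫⁻ x, g x ∂ν := by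
  rw [← smul_eq_mul, ← lintegral_smul_measure]
  exact lintegral_mono' h le_rfl

lemma mul_tripleIntegral_le_first {c : ℝ≥0∞} (h : c • μ₁ ≤ ν) :
    c * tripleIntegral μ₁ μ₂ μ₃ T ≤ tripleIntegral ν μ₂ μ₃ T :=
  mul_lintegral_le_of_smul_le h _

lemma mul_tripleIntegral_le_second {c : ℝ≥0∞} (hc : c ≠ ∞) (h : c • μ₂ ≤ ν) :
    c * tripleIntegral μ₁ μ₂ μ₃ T ≤ tripleIntegral μ₁ ν μ₃ T := by
  unfold tripleIntegral
  rw [← lintegral_const_mul' _ _ hc]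
  exact lintegral_mono fun x => mul_lintegral_le_of_smul_le h _

lemma mul_tripleIntegral_le_third {c : ℝ≥0∞} (hc : c ≠ ∞) (h : c • μ₃ ≤ ν) :
    c * tripleIntegral μ₁ μ₂ μ₃ T ≤ tripleIntegral μ₁ μ₂ ν T := by
  unfold tripleIntegral
  rw [← lintegral_const_mul' _ _ hc]
  refine lintegral_mono fun x => ?_
  rw [← lintegral_const_mul' _ _ hc]
  exact lintegral_mono fun y => mul_lintegral_le_of_smul_le h _

/-- Exchanging the states `a`, `c` of the outer two of three levels, through the configurations
`(a, x, c)`, `(x, a, c)`, `(x, c, a)`, `(c, x, a)`. Each exchanged pair is weighted by the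
distribution of the colder of its two levels. -/
lemma mul_exchange_outer_le {u v z : Measure Y} [IsProbabilityMeasure u] [IsProbabilityMeasure v]
    [IsProbabilityMeasure z] {c : ℝ≥0∞} (hc : c ≠ ∞) (hvu : c • v ≤ u) (hzv : c • z ≤ v)
    {p : Y → Y → Y → ℝ} (hp : Measurable fun q : Y × Y × Y => p q.1 q.2.1 q.2.2) :
    c * tripleIntegral v z z (fun x a b => sqDist (p a x b) (p b x a))
      ≤ 3 * (2 * tripleIntegral z v v (fun b a x => sqDist (p a x b) (p x a b))
        + tripleIntegral u z z (fun x a b => sqDist (p x a b) (p x b a))) := by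
  have h1 : c * tripleIntegral v z z (fun x a b => sqDist (p a x b) (p x a b))
      ≤ tripleIntegral z v v (fun b a x => sqDist (p a x b) (p x a b)) := by
    refine (mul_tripleIntegral_le_second hc hzv).trans_eq ?_
    rw [tripleIntegral_swap_right (by fun_prop), tripleIntegral_swap_left (by fun_prop),
      tripleIntegral_swap_right (by fun_prop)]
  have h2 : c * tripleIntegral v z z (fun x a b => sqDist (p x a b) (p x b a))
      ≤ tripleIntegral u z z (fun x a b => sqDist (p x a b) (p x b a)) :=
    mul_tripleIntegral_le_first hvu
  have h3 : c * tripleIntegral v z z (fun x a b => sqDist (p x b a) (p b x a))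
      ≤ tripleIntegral z v v (fun b a x => sqDist (p a x b) (p x a b)) := by
    refine (mul_tripleIntegral_le_third hc hzv).trans_eq ?_
    rw [tripleIntegral_swap_left (by fun_prop)]
  calc c * tripleIntegral v z z (fun x a b => sqDist (p a x b) (p b x a))
      ≤ c * tripleIntegral v z z (fun x a b => 3 * (sqDist (p a x b) (p x a b)
          + sqDist (p x a b) (p x b a) + sqDist (p x b a) (p b x a))) := by
        gcongr
        exact tripleIntegral_mono fun x a b => sqDist_triangle_three _ _ _ _
    _ = 3 * (c * tripleIntegral v z z (fun x a b => sqDist (p a x b) (p x a b))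
          + c * tripleIntegral v z z (fun x a b => sqDist (p x a b) (p x b a))
          + c * tripleIntegral v z z (fun x a b => sqDist (p x b a) (p b x a))) := by
        rw [tripleIntegral_const_mul (by norm_num), tripleIntegral_add (by fun_prop),
          tripleIntegral_add (by fun_prop)]
        ring
    _ ≤ _ := by
        grw [h1, h2, h3]
        apply le_of_eq
        ring

/-- Changing the state of the colder of two levels from `k` to `a` while the hotter one is in state
`x`, through the configurations `(x, k)`, `(y, k)`, `(k, y)`, `(a, y)`, `(y, a)`, `(x, a)`, where
`y` has the distribution of the colder level. -/
lemma sq_mul_resample_cold_le {u v : Measure Y} [IsProbabilityMeasure u] [IsProbabilityMeasure v]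
    {c : ℝ≥0∞} (hc : c ≤ 1) (hvu : c • v ≤ u)
    {p : Y → Y → ℝ} (hp : Measurable fun q : Y × Y => p q.1 q.2) :
    c ^ 2 * tripleIntegral u v v (fun x k a => sqDist (p x k) (p x a))
      ≤ 5 * (3 * tripleIntegral v u u (fun k x y => sqDist (p x k) (p y k))
        + 2 * ∫⁻ a, ∫⁻ y, sqDist (p a y) (p y a) ∂v ∂v) := by
  have hct : c ≠ ∞ := (hc.trans_lt ENNReal.one_lt_top).ne
  have hc2 : c ^ 2 ≤ c := by
    calc c ^ 2 = c * c := sq c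
      _ ≤ c * 1 := by gcongr
      _ = c := mul_one c
  set A := tripleIntegral v u u (fun k x y => sqDist (p x k) (p y k)) with hA
  set E := ∫⁻ a, ∫⁻ y, sqDist (p a y) (p y a) ∂v ∂v with hE
  have h1 : c ^ 2 * ∫⁻ x, ∫⁻ y, ∫⁻ k, sqDist (p x k) (p y k) ∂v ∂v ∂u ≤ A := by
    calc _ ≤ c * tripleIntegral u v v (fun x y k => sqDist (p x k) (p y k)) := by
          gcongr; rfl
      _ ≤ tripleIntegral u u v (fun x y k => sqDist (p x k) (p y k)) :=
          mul_tripleIntegral_le_second hct hvu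
      _ = A := by
          rw [tripleIntegral_swap_right (by fun_prop), tripleIntegral_swap_left (by fun_prop)]
  have h3 : c ^ 2 * tripleIntegral v v v (fun k a y => sqDist (p k y) (p a y)) ≤ A := by
    calc _ = c * (c * tripleIntegral v v v (fun k a y => sqDist (p k y) (p a y))) := by ring
      _ ≤ c * tripleIntegral u v v (fun k a y => sqDist (p k y) (p a y)) := by
          gcongr; exact mul_tripleIntegral_le_first hvu
      _ ≤ tripleIntegral u u v (fun k a y => sqDist (p k y) (p a y)) :=
          mul_tripleIntegral_le_second hct hvu
      _ = A := by
          rw [tripleIntegral_swap_right (by fun_prop), tripleIntegral_swap_left (by fun_prop)]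
  have h2 : c ^ 2 * E ≤ E := by
    calc c ^ 2 * E ≤ 1 * E := by gcongr; exact hc2.trans hc
      _ = E := one_mul E
  -- The integrand does not depend on `y`, over which both sides are averaged.
  have hpath : ∀ x, ∫⁻ k, ∫⁻ a, sqDist (p x k) (p x a) ∂v ∂v
      ≤ 5 * (∫⁻ y, ∫⁻ k, sqDist (p x k) (p y k) ∂v ∂v + E
        + tripleIntegral v v v (fun k a y => sqDist (p k y) (p a y)) + E
        + ∫⁻ y, ∫⁻ k, sqDist (p x k) (p y k) ∂v ∂v) := by
    intro x
    calc ∫⁻ k, ∫⁻ a, sqDist (p x k) (p x a) ∂v ∂v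
        = tripleIntegral v v v (fun k a _ => sqDist (p x k) (p x a)) := by simp [tripleIntegral]
      _ ≤ tripleIntegral v v v (fun k a y => 5 * (sqDist (p x k) (p y k) + sqDist (p y k) (p k y)
            + sqDist (p k y) (p a y) + sqDist (p a y) (p y a) + sqDist (p y a) (p x a))) :=
          tripleIntegral_mono fun k a y => sqDist_triangle_five _ _ _ _ _ _
      _ = 5 * (tripleIntegral v v v (fun k _ y => sqDist (p x k) (p y k))
            + tripleIntegral v v v (fun k _ y => sqDist (p y k) (p k y))
            + tripleIntegral v v v (fun k a y => sqDist (p k y) (p a y))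
            + tripleIntegral v v v (fun _ a y => sqDist (p a y) (p y a))
            + tripleIntegral v v v (fun _ a y => sqDist (p y a) (p x a))) := by
          rw [tripleIntegral_const_mul (by norm_num)]
          repeat rw [tripleIntegral_add (by fun_prop)]
      _ = _ := by
          congr 2
          · congr 1
            · congr 1
              congr 1
              · rw [tripleIntegral_swap_right (by fun_prop), tripleIntegral_swap_left (by fun_prop)]
                simp [tripleIntegral]
              · simp only [tripleIntegral, lintegral_const, measure_univ, mul_one, E]
                simp_rw [sqDist_comm (p _ _) (p _ _)]
            · simp [tripleIntegral, E]
          · simp only [tripleIntegral, lintegral_const, measure_univ, mul_one]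
            rw [lintegral_lintegral_swap (by fun_prop)]
            simp_rw [sqDist_comm (p x _)]
  calc c ^ 2 * tripleIntegral u v v (fun x k a => sqDist (p x k) (p x a))
      ≤ c ^ 2 * ∫⁻ x, 5 * (∫⁻ y, ∫⁻ k, sqDist (p x k) (p y k) ∂v ∂v + E
        + tripleIntegral v v v (fun k a y => sqDist (p k y) (p a y)) + E
        + ∫⁻ y, ∫⁻ k, sqDist (p x k) (p y k) ∂v ∂v) ∂u := by
        gcongr
        exact lintegral_mono hpath
    _ = 5 * (2 * (c ^ 2 * ∫⁻ x, ∫⁻ y, ∫⁻ k, sqDist (p x k) (p y k) ∂v ∂v ∂u)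
        + c ^ 2 * tripleIntegral v v v (fun k a y => sqDist (p k y) (p a y))
        + 2 * (c ^ 2 * E)) := by
        rw [lintegral_const_mul' _ _ (by norm_num)]
        repeat rw [lintegral_add_left (by fun_prop)]
        simp only [lintegral_const, measure_univ, mul_one]
        ring
    _ ≤ 5 * (2 * A + A + 2 * E) := by gcongr
    _ = _ := by ring

end Triple

section Levels

variable {ι Y : Type*} [Fintype ι] [DecidableEq ι] [MeasurableSpace Y] (w : ι → Measure Y)
  [∀ i, IsProbabilityMeasure (w i)]

/-- The mean square effect of exchanging the states of levels `i` and `j`, where both states are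
drawn from the distribution of level `j` and all others from their own. -/
def swapSpread (i j : ι) (F : (ι → Y) → ℝ) : ℝ≥0∞ :=
  ∫⁻ σ, ∫⁻ a, ∫⁻ b, sqDist (F (Function.update (Function.update σ i a) j b))
    (F (Function.update (Function.update σ i b) j a)) ∂(w j) ∂(w j) ∂(Measure.pi w)

variable {w} {F : (ι → Y) → ℝ}

/-- An exchange of two levels is composed of exchanges with a level in between. -/
lemma mul_swapSpread_le {i h j : ι} (hih : i ≠ h) (hij : i ≠ j) (hhj : h ≠ j) {c : ℝ≥0∞}
    (hc : c ≠ ∞) (hhi : c • w h ≤ w i) (hjh : c • w j ≤ w h) (hF : Measurable F) :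
    c * swapSpread w i j F ≤ 3 * (2 * swapSpread w i h F + swapSpread w h j F) := by
  let p : (ι → Y) → Y → Y → Y → ℝ := fun σ a x b =>
    F (Function.update (Function.update (Function.update σ i a) h x) j b)
  have hp : ∀ σ, Measurable fun q : Y × Y × Y => p σ q.1 q.2.1 q.2.2 := fun σ => by fun_prop
  have hij' : swapSpread w i j F
      = ∫⁻ σ, tripleIntegral (w h) (w j) (w j) (fun x a b => sqDist (p σ a x b) (p σ b x a))
        ∂(Measure.pi w) := by
    unfold swapSpread
    rw [← lintegral_update w h (by fun_prop)]
    simp only [tripleIntegral, p, Function.update_comm hih.symm]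
  have hih' : swapSpread w i h F
      = ∫⁻ σ, tripleIntegral (w j) (w h) (w h) (fun b a x => sqDist (p σ a x b) (p σ x a b))
        ∂(Measure.pi w) := by
    unfold swapSpread
    rw [← lintegral_update w j (by fun_prop)]
    simp only [tripleIntegral, p, Function.update_comm hij.symm, Function.update_comm hhj.symm]
  have hhj' : swapSpread w h j F
      = ∫⁻ σ, tripleIntegral (w i) (w j) (w j) (fun x a b => sqDist (p σ x a b) (p σ x b a))
        ∂(Measure.pi w) := by
    unfold swapSpread
    rw [← lintegral_update w i (by fun_prop)]
    rfl
  have hm : ∀ (i j k : ι) {T : (ι → Y) → Y → Y → Y → ℝ≥0∞},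
      Measurable (fun q : (ι → Y) × Y × Y × Y => T q.1 q.2.1 q.2.2.1 q.2.2.2) →
      Measurable fun σ => tripleIntegral (w i) (w j) (w k) (T σ) := by
    intro i j k T hT
    unfold tripleIntegral
    fun_prop
  rw [hij', hih', hhj', ← lintegral_const_mul' _ _ hc, ← lintegral_const_mul' 2 _ (by norm_num),
    ← lintegral_add_left ((hm _ _ _ (by fun_prop)).const_mul _),
    ← lintegral_const_mul' 3 _ (by norm_num)]
  exact lintegral_mono fun σ => mul_exchange_outer_le hc hhi hjh (hp σ)

/-- Resampling the colder of two levels is composed of resampling the hotter one and exchanges. -/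
lemma sq_mul_coordSpread_le {i j : ι} (hij : i ≠ j) {c : ℝ≥0∞} (hc : c ≤ 1)
    (hji : c • w j ≤ w i) (hF : Measurable F) :
    c ^ 2 * coordSpread w j F ≤ 5 * (3 * coordSpread w i F + 2 * swapSpread w i j F) := by
  let p : (ι → Y) → Y → Y → ℝ := fun σ x k => F (Function.update (Function.update σ i x) j k)
  have hp : ∀ σ, Measurable fun q : Y × Y => p σ q.1 q.2 := fun σ => by fun_prop
  have hj : coordSpread w j F
      = ∫⁻ σ, tripleIntegral (w i) (w j) (w j) (fun x k a => sqDist (p σ x k) (p σ x a))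
        ∂(Measure.pi w) := by
    unfold coordSpread
    rw [← lintegral_update w j (by fun_prop), ← lintegral_update w i (by fun_prop)]
    simp only [tripleIntegral, p, Function.update_idem]
  have hi : coordSpread w i F
      = ∫⁻ σ, tripleIntegral (w j) (w i) (w i) (fun k x y => sqDist (p σ x k) (p σ y k))
        ∂(Measure.pi w) := by
    unfold coordSpread
    rw [← lintegral_update w i (by fun_prop), ← lintegral_update w j (by fun_prop)]
    simp only [tripleIntegral, p, Function.update_idem, Function.update_comm hij.symm]
  have hm : Measurable fun σ =>
      tripleIntegral (w j) (w i) (w i) (fun k x y => sqDist (p σ x k) (p σ y k)) := by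
    unfold tripleIntegral
    fun_prop
  rw [hj, hi, swapSpread, ← lintegral_const_mul' _ _ 
      (ENNReal.pow_ne_top (hc.trans_lt ENNReal.one_lt_top).ne),
    ← lintegral_const_mul' 3 _ (by norm_num), ← lintegral_const_mul' 2 _ (by norm_num),
    ← lintegral_add_left (hm.const_mul _), ← lintegral_const_mul' 5 _ (by norm_num)]
  exact lintegral_mono fun σ => sq_mul_resample_cold_le hc hji (hp σ)

end Levels

section Ladder

lemma swapLevels_update {L : ℕ} {Y : Type*} (l : Fin L) (σ : Fin (L + 1) → Y) (a b : Y) :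
    swapLevels l (Function.update (Function.update σ l.castSucc a) l.succ b)
      = Function.update (Function.update σ l.castSucc b) l.succ a := by
  have hne : l.castSucc ≠ l.succ := Fin.castSucc_lt_succ.ne
  ext j
  by_cases h1 : j = l.castSucc
  · subst h1; simp [swapLevels, hne]
  · by_cases h2 : j = l.succ
    · subst h2; simp [swapLevels, hne]
    · simp [swapLevels, Equiv.swap_apply_of_ne_of_ne h1 h2, h1, h2]

@[fun_prop]
lemma measurable_swapLevels {L : ℕ} {Y : Type*} [MeasurableSpace Y] (l : Fin L) :
    Measurable (swapLevels (X := Y) l) :=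
  measurable_pi_lambda _ fun _ => measurable_pi_apply _

variable {L : ℕ} {Y : Type*} [MeasurableSpace Y] {w : Fin (L + 1) → Measure Y}
  [∀ i, IsProbabilityMeasure (w i)] {F : (Fin (L + 1) → Y) → ℝ}

/-- Exchanging adjacent levels at stationarity dominates the exchange of two states drawn from the
colder level. -/
lemma mul_swapSpread_adjacent_le {l : Fin L} {c : ℝ≥0∞} (hc : c ≠ ∞)
    (h : c • w l.succ ≤ w l.castSucc) (hF : Measurable F) :
    c * swapSpread w l.castSucc l.succ F
      ≤ ∫⁻ σ, sqDist (F σ) (F (swapLevels l σ)) ∂(Measure.pi w) := by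
  rw [← lintegral_update w l.succ (by fun_prop), ← lintegral_update w l.castSucc (by fun_prop)]
  simp_rw [swapLevels_update]
  rw [swapSpread, ← lintegral_const_mul' _ _ hc]
  exact lintegral_mono fun σ => mul_lintegral_le_of_smul_le h _

/-- Exchanges of levels at distance at most `2 ^ n` are built from exchanges of adjacent levels by
halving the distance `n` times. -/
lemma pow_mul_swapSpread_le {c M : ℝ≥0∞} (hc : c ≤ 1) (hw : ∀ i j, i ≤ j → c • w j ≤ w i)
    (hF : Measurable F) (hM : ∀ l : Fin L, swapSpread w l.castSucc l.succ F ≤ M) (n : ℕ) :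
    ∀ i j : Fin (L + 1), i < j → (j : ℕ) ≤ i + 2 ^ n →
      c ^ n * swapSpread w i j F ≤ 9 ^ n * M := by
  have hct : c ≠ ∞ := (hc.trans_lt ENNReal.one_lt_top).ne
  have hadj : ∀ i j : Fin (L + 1), (j : ℕ) = i + 1 → swapSpread w i j F ≤ M := by
    intro i j hij
    have hi : (i : ℕ) < L := by omega
    have := hM ⟨i, hi⟩
    rwa [show (Fin.castSucc ⟨i, hi⟩ : Fin (L + 1)) = i from Fin.ext rfl,
      show (Fin.succ ⟨i, hi⟩ : Fin (L + 1)) = j from Fin.ext (by simp [hij])] at this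
  induction n with
  | zero =>
    intro i j hij hle
    simpa using hadj i j (by have := Fin.lt_def.1 hij; omega)
  | succ n ih =>
    intro i j hij hle
    have hij' := Fin.lt_def.1 hij
    rw [pow_succ] at hle
    by_cases h1 : (j : ℕ) = i + 1
    · calc c ^ (n + 1) * swapSpread w i j F ≤ 1 * M := by
            gcongr
            · exact pow_le_one' hc _
            · exact hadj i j h1
        _ ≤ 9 ^ (n + 1) * M := by
            gcongr
            exact one_le_pow₀ (by norm_num)
    · let h : Fin (L + 1) := ⟨(i + j) / 2, by omega⟩
      have hh : (h : ℕ) = (i + j) / 2 := rfl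
      have hih : i < h := Fin.lt_def.2 (by omega)
      have hhj : h < j := Fin.lt_def.2 (by omega)
      calc c ^ (n + 1) * swapSpread w i j F = c ^ n * (c * swapSpread w i j F) := by ring
        _ ≤ c ^ n * (3 * (2 * swapSpread w i h F + swapSpread w h j F)) := by
            grw [mul_swapSpread_le hih.ne hij.ne hhj.ne hct (hw i h hih.le) (hw h j hhj.le) hF]
        _ = 3 * (2 * (c ^ n * swapSpread w i h F) + c ^ n * swapSpread w h j F) := by ring
        _ ≤ 3 * (2 * (9 ^ n * M) + 9 ^ n * M) := by
            grw [ih i h hih (by omega), ih h j hhj (by omega)]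
        _ = 9 ^ (n + 1) * M := by ring

end Ladder

/-! ### Restriction and projection of one level to the blocks of the partition -/

section Restrict

variable {X : Type*} [MeasurableSpace X] {P : Kernel X X} {μ : Measure X} {A : Set X}

lemma lintegral_restrictTo (hA : MeasurableSet A) (θ : A) {g : X → ℝ≥0∞} (hg : Measurable g) :
    ∫⁻ y, g y ∂(restrictTo P A hA θ) = ∫⁻ y in A, g y ∂(P θ) + P θ Aᶜ * g θ := by
  change ∫⁻ y : A, g y ∂((P θ).comap Subtype.val + P θ Aᶜ • Measure.dirac θ) = _
  rw [lintegral_add_measure, lintegral_subtype_comap hA g, lintegral_smul_measure,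
    lintegral_dirac' θ (f := fun a : A => g a) (by fun_prop), smul_eq_mul]

lemma restrictTo_apply (hA : MeasurableSet A) (θ : A) {s : Set A} (hs : MeasurableSet s) :
    restrictTo P A hA θ s = P θ (Subtype.val '' s) + P θ Aᶜ * s.indicator 1 θ := by
  change ((P θ).comap Subtype.val + P θ Aᶜ • Measure.dirac θ : Measure A) s = _
  rw [Measure.add_apply, Measure.smul_apply, smul_eq_mul, Measure.dirac_apply' _ hs,
    (MeasurableEmbedding.subtype_coe hA).comap_apply]

instance isMarkovKernel_restrictTo (hA : MeasurableSet A)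
    [IsMarkovKernel P] : IsMarkovKernel (restrictTo P A hA) := by
  refine ⟨fun θ => ⟨?_⟩⟩
  rw [restrictTo_apply hA θ MeasurableSet.univ]
  simpa using measure_add_measure_compl (μ := P θ) hA

lemma lintegral_condOn (hA : MeasurableSet A) (g : X → ℝ≥0∞) :
    ∫⁻ x : A, g x ∂(condOn μ A) = (μ A)⁻¹ * ∫⁻ x in A, g x ∂μ := by
  rw [condOn, lintegral_subtype_comap hA g, ProbabilityTheory.cond, Measure.restrict_smul, lintegral_smul_measure,
    Measure.restrict_restrict hA, Set.inter_self, smul_eq_mul]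

lemma lintegral_cond (g : X → ℝ≥0∞) :
    ∫⁻ x, g x ∂(ProbabilityTheory.cond μ A) = (μ A)⁻¹ * ∫⁻ x in A, g x ∂μ := by
  rw [ProbabilityTheory.cond, lintegral_smul_measure, smul_eq_mul]

lemma isProbabilityMeasure_condOn (hA : MeasurableSet A) [IsFiniteMeasure μ] (h : μ A ≠ 0) :
    IsProbabilityMeasure (condOn μ A) := by
  refine ⟨?_⟩
  have := lintegral_condOn (μ := μ) hA (fun _ => 1)
  simpa [ENNReal.inv_mul_cancel h (measure_ne_top μ A)] using this

lemma invariant_restrictTo (hA : MeasurableSet A)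
    [IsMarkovKernel P] [IsFiniteMeasure μ] (hP : P.IsReversible μ) :
    (restrictTo P A hA).Invariant (condOn μ A) := by
  refine Measure.ext fun s hs => ?_
  have hB : MeasurableSet (Subtype.val '' s) := hA.subtype_image hs
  have hBA : Subtype.val '' s ⊆ A := by simp
  rw [Measure.bind_apply hs (Kernel.aemeasurable _)]
  have h1 : ∀ θ : A, restrictTo P A hA θ s
      = (fun x => P x (Subtype.val '' s)
        + (Subtype.val '' s).indicator (fun x => P x Aᶜ) x) θ := by
    intro θ
    rw [restrictTo_apply hA θ hs]
    congr 1
    by_cases h : θ ∈ s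
    · have : (θ : X) ∈ Subtype.val '' s := ⟨θ, h, rfl⟩
      rw [Set.indicator_of_mem h, Set.indicator_of_mem this]; simp
    · have : (θ : X) ∉ Subtype.val '' s := by simpa using h
      rw [Set.indicator_of_notMem h, Set.indicator_of_notMem this]; simp
  simp_rw [h1]
  rw [lintegral_condOn hA (fun x => P x (Subtype.val '' s)
    + (Subtype.val '' s).indicator (fun x => P x Aᶜ) x), lintegral_add_left (P.measurable_coe hB), hP hA hB,
    lintegral_indicator hB, Measure.restrict_restrict hB, Set.inter_eq_left.2 hBA,
    ← lintegral_add_left (P.measurable_coe hA)]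
  simp_rw [measure_add_measure_compl hA, measure_univ]
  rw [lintegral_const, Measure.restrict_apply_univ, one_mul, condOn,
    (MeasurableEmbedding.subtype_coe hA).comap_apply, cond_apply hA, Set.inter_eq_right.2 hBA]

/-- The spectral gap of the restricted kernel bounds the spread of a function within a block. -/
lemma spectralGap_restrictTo_mul_le (hA : MeasurableSet A) [IsMarkovKernel P] [IsFiniteMeasure μ]
    (hP : P.IsReversible μ) (h0 : μ A ≠ 0) {f : X → ℝ} (hf : Measurable f)
    {M : ℝ} (hM : ∀ x, |f x| ≤ M) :
    ENNReal.ofReal (spectralGap (restrictTo P A hA) (condOn μ A)) *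
        ∫⁻ x in A, ∫⁻ y, sqDist (f x) (f y) ∂(ProbabilityTheory.cond μ A) ∂μ
      ≤ ∫⁻ x in A, ∫⁻ y, sqDist (f x) (f y) ∂(P x) ∂μ := by
  have := isProbabilityMeasure_condOn hA h0
  have h1 := ofReal_spectralGap_mul_spread_le (invariant_restrictTo hA hP)
    (f := fun x : A => f x) (by fun_prop)
    (MemLp.of_bound (hf.comp measurable_subtype_coe).aestronglyMeasurable M (
      Filter.Eventually.of_forall fun x => hM x))
  have h2 : spread (condOn μ A) (fun x : A => f x)
      = (μ A)⁻¹ * ∫⁻ x in A, ∫⁻ y, sqDist (f x) (f y) ∂(ProbabilityTheory.cond μ A) ∂μ := by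
    unfold spread
    rw [← lintegral_condOn hA]
    refine lintegral_congr fun x => ?_
    rw [lintegral_condOn hA (fun y => sqDist (f x) (f y)), lintegral_cond]
  have h3 : energy (restrictTo P A hA) (condOn μ A) (fun x : A => f x)
      = (μ A)⁻¹ * ∫⁻ x in A, ∫⁻ y in A, sqDist (f x) (f y) ∂(P x) ∂μ := by
    unfold energy
    rw [← lintegral_condOn hA]
    refine lintegral_congr fun x => ?_
    rw [lintegral_restrictTo hA x (g := fun y => sqDist (f x) (f y)) (by fun_prop), sqDist_self,
      mul_zero, add_zero]
  rw [h2, h3, mul_left_comm] at h1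
  refine ((ENNReal.mul_le_mul_iff_right (ENNReal.inv_ne_zero.2 (measure_ne_top μ A))
    (ENNReal.inv_ne_top.2 h0)).1 h1).trans ?_
  exact lintegral_mono fun x => lintegral_mono' Measure.restrict_le_self le_rfl

end Restrict

section Blocks

variable {X : Type*} [MeasurableSpace X] {m : ℕ} {lab : X → Fin m}
  {P : Kernel X X} {μ : Measure X}

/-- The conditional distribution of `μ` given the block with label `k`. -/
def blockLaw (μ : Measure X) (lab : X → Fin m) : Kernel (Fin m) X :=
  Kernel.ofFunOfCountable fun k => ProbabilityTheory.cond μ (lab ⁻¹' {k})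

lemma isMarkovKernel_blockLaw [IsFiniteMeasure μ] (h0 : ∀ k, μ (lab ⁻¹' {k}) ≠ 0) :
    IsMarkovKernel (blockLaw μ lab) :=
  ⟨fun k => cond_isProbabilityMeasure (h0 k)⟩

lemma lintegral_eq_sum_blocks (hlab : Measurable lab)
    (g : X → ℝ≥0∞) :
    ∫⁻ x, g x ∂μ = ∑ k, ∫⁻ x in lab ⁻¹' {k}, g x ∂μ := by
  have hU : ⋃ k, lab ⁻¹' {k} = Set.univ := by ext x; simp
  rw [← setLIntegral_univ, ← hU, lintegral_iUnion (fun k => hlab (measurableSet_singleton k)),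
    tsum_fintype]
  intro k l hkl
  exact Disjoint.preimage _ (by simpa using hkl)

lemma lintegral_blockLaw (hlab : Measurable lab)
    [IsFiniteMeasure μ] (h0 : ∀ k, μ (lab ⁻¹' {k}) ≠ 0) {s : Set X}
    (hs : MeasurableSet s) : ∑ k, μ (lab ⁻¹' {k}) * blockLaw μ lab k s = μ s := by
  have := lintegral_eq_sum_blocks hlab (μ := μ) (s.indicator 1)
  rw [lintegral_indicator_one hs] at this
  rw [this]
  refine Finset.sum_congr rfl fun k _ => ?_
  have hk : MeasurableSet (lab ⁻¹' {k}) := hlab (measurableSet_singleton k)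
  rw [lintegral_indicator_one hs, Measure.restrict_apply hs]
  change μ (lab ⁻¹' {k}) * ProbabilityTheory.cond μ (lab ⁻¹' {k}) s = _
  rw [cond_apply hk, ← mul_assoc, ENNReal.mul_inv_cancel (h0 k) (measure_ne_top _ _), one_mul,
    Set.inter_comm]

/-- The gaps of the restricted kernels bound the mean square effect of resampling within the
current block. -/
lemma mul_lintegral_blockLaw_le (hlab : Measurable lab)
    [IsMarkovKernel P] [IsFiniteMeasure μ]
    (hP : P.IsReversible μ) (h0 : ∀ k, μ (lab ⁻¹' {k}) ≠ 0) {γ : ℝ}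
    (hγ : ∀ k, γ ≤ spectralGap (restrictTo P (lab ⁻¹' {k}) (hlab (measurableSet_singleton k)))
      (condOn μ (lab ⁻¹' {k})))
    {f : X → ℝ} (hf : Measurable f) {M : ℝ} (hM : ∀ x, |f x| ≤ M) :
    ENNReal.ofReal γ * ∫⁻ x, ∫⁻ y, sqDist (f x) (f y) ∂(blockLaw μ lab (lab x)) ∂μ
      ≤ energy P μ f := by
  unfold energy
  rw [lintegral_eq_sum_blocks hlab, Finset.mul_sum, lintegral_eq_sum_blocks hlab (μ := μ)]
  refine Finset.sum_le_sum fun k _ => ?_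
  have hk : MeasurableSet (lab ⁻¹' {k}) := hlab (measurableSet_singleton k)
  refine le_trans ?_ (spectralGap_restrictTo_mul_le hk hP (h0 k) hf hM)
  refine mul_le_mul' (ENNReal.ofReal_le_ofReal (hγ k)) (le_of_eq ?_)
  refine setLIntegral_congr_fun hk fun x hx => ?_
  rw [show lab x = k from hx]
  rfl

lemma projMeasure_eq_map (hlab : Measurable lab)
    : projMeasure μ (fun k => lab ⁻¹' {k}) = μ.map lab := by
  refine Measure.ext fun s hs => ?_
  rw [← lintegral_indicator_one hs, ← lintegral_indicator_one hs, lintegral_fintype,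
    lintegral_fintype]
  refine Finset.sum_congr rfl fun k _ => ?_
  rw [Measure.map_apply hlab (measurableSet_singleton k)]
  congr 1
  simp [projMeasure, Measure.finsetSum_apply, Set.indicator_apply]

lemma mul_lintegral_projKernel (hlab : Measurable lab)
    [IsFiniteMeasure μ] (h0 : ∀ k, μ (lab ⁻¹' {k}) ≠ 0) (k : Fin m)
    (g : Fin m → ℝ≥0∞) :
    μ (lab ⁻¹' {k}) * ∫⁻ l, g l ∂(projKernel P μ (fun k => lab ⁻¹' {k}) k)
      = ∫⁻ x in lab ⁻¹' {k}, ∫⁻ y, g (lab y) ∂(P x) ∂μ := by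
  have hl : ∀ l, MeasurableSet (lab ⁻¹' {l}) := fun l => hlab (measurableSet_singleton l)
  have h1 : ∀ x, ∫⁻ y, g (lab y) ∂(P x) = ∑ l, g l * P x (lab ⁻¹' {l}) := by
    intro x
    rw [← lintegral_map (f := g) measurable_from_top hlab, lintegral_fintype]
    simp_rw [Measure.map_apply hlab (measurableSet_singleton _)]
  simp_rw [h1]
  rw [lintegral_finsetSum _ fun l _ => (P.measurable_coe (hl l)).const_mul _]
  change μ (lab ⁻¹' {k}) * ∫⁻ l, g l ∂(∑ k₂, ((μ (lab ⁻¹' {k}))⁻¹ *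
    ∫⁻ θ in lab ⁻¹' {k}, P θ (lab ⁻¹' {k₂}) ∂μ) • Measure.dirac k₂) = _
  rw [lintegral_finsetSum_measure, Finset.mul_sum]
  refine Finset.sum_congr rfl fun l _ => ?_
  rw [lintegral_smul_measure, lintegral_dirac, smul_eq_mul, ← mul_assoc, ← mul_assoc,
    ENNReal.mul_inv_cancel (h0 k) (measure_ne_top _ _), one_mul,
    lintegral_const_mul _ (P.measurable_coe (hl l)), mul_comm]

lemma isMarkovKernel_projKernel (hlab : Measurable lab)
    [IsMarkovKernel P] [IsFiniteMeasure μ]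
    (h0 : ∀ k, μ (lab ⁻¹' {k}) ≠ 0) : IsMarkovKernel (projKernel P μ fun k => lab ⁻¹' {k}) := by
  refine ⟨fun k => ⟨?_⟩⟩
  have := mul_lintegral_projKernel hlab (P := P) h0 k (fun _ => 1)
  simp only [lintegral_const, one_mul, measure_univ, Measure.restrict_apply_univ] at this
  rwa [ENNReal.mul_eq_left (h0 k) (measure_ne_top _ _)] at this

lemma invariant_projKernel (hlab : Measurable lab)
    [IsMarkovKernel P] [IsFiniteMeasure μ] (hP : P.Invariant μ)
    (h0 : ∀ k, μ (lab ⁻¹' {k}) ≠ 0) :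
    (projKernel P μ fun k => lab ⁻¹' {k}).Invariant (μ.map lab) := by
  refine Measure.ext fun s hs => ?_
  rw [Measure.bind_apply hs (Kernel.aemeasurable _), lintegral_fintype]
  have h1 : ∀ k, projKernel P μ (fun k => lab ⁻¹' {k}) k s * (μ.map lab) {k}
      = ∫⁻ x in lab ⁻¹' {k}, ∫⁻ y, s.indicator 1 (lab y) ∂(P x) ∂μ := by
    intro k
    rw [Measure.map_apply hlab (measurableSet_singleton k), mul_comm,
      ← lintegral_indicator_one hs, mul_lintegral_projKernel hlab h0 k]
  simp_rw [h1]
  rw [← lintegral_eq_sum_blocks hlab, lintegral_lintegral_of_invariant hP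
    (g := fun y => s.indicator 1 (lab y)) (by fun_prop), ← lintegral_map (by fun_prop) hlab,
    lintegral_indicator_one hs]

/-- The spectral gap of the projected chain bounds the spread of a function of the label. -/
lemma spectralGap_projKernel_mul_le (hlab : Measurable lab)
    [IsMarkovKernel P] [IsProbabilityMeasure μ]
    (hP : P.Invariant μ) (h0 : ∀ k, μ (lab ⁻¹' {k}) ≠ 0) (h : Fin m → ℝ) :
    ENNReal.ofReal (spectralGap (projKernel P μ fun k => lab ⁻¹' {k}) (μ.map lab)) *
        spread (μ.map lab) h ≤ energy P μ (fun x => h (lab x)) := by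
  have := isMarkovKernel_projKernel hlab (P := P) h0
  have := Measure.isProbabilityMeasure_map (μ := μ) hlab.aemeasurable
  obtain ⟨M, hM⟩ : ∃ M, ∀ k, |h k| ≤ M :=
    ⟨∑ k, |h k|, fun k => Finset.single_le_sum (f := fun k => |h k|)
      (fun _ _ => abs_nonneg _) (Finset.mem_univ k)⟩
  refine (ofReal_spectralGap_mul_spread_le (invariant_projKernel hlab hP h0)
    measurable_from_top (MemLp.of_bound measurable_from_top.aestronglyMeasurable M
      (Filter.Eventually.of_forall fun x => hM x))).trans_eq ?_
  unfold energy
  rw [lintegral_fintype, lintegral_eq_sum_blocks hlab]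
  refine Finset.sum_congr rfl fun k _ => ?_
  have hk : MeasurableSet (lab ⁻¹' {k}) := hlab (measurableSet_singleton k)
  rw [Measure.map_apply hlab (measurableSet_singleton k), mul_comm,
    mul_lintegral_projKernel hlab h0 k]
  refine setLIntegral_congr_fun hk fun x hx => ?_
  simp only [show lab x = k from hx]

end Blocks

/-! ### Averaging over the blocks of the product space -/

lemma lintegral_sqDist_integral_le {X : Type*} [MeasurableSpace X] {μ : Measure X}
    [IsProbabilityMeasure μ] {f : X → ℝ} (hf : Measurable f) {M : ℝ} (hM : ∀ x, |f x| ≤ M) :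
    ∫⁻ x, sqDist (f x) (∫ y, f y ∂μ) ∂μ ≤ spread μ f := by
  have h2 : MemLp f 2 μ :=
    MemLp.of_bound hf.aestronglyMeasurable M (Filter.Eventually.of_forall hM)
  rw [← ofReal_two_mul_variance hf h2, variance_eq_integral hf.aemeasurable]
  unfold sqDist
  have hi : Integrable (fun x => (f x - ∫ y, f y ∂μ) ^ 2) μ :=
    (h2.sub (memLp_const _)).integrable_sq
  rw [← ofReal_integral_eq_lintegral_ofReal hi
    (Filter.Eventually.of_forall fun x => sq_nonneg _)]
  refine ENNReal.ofReal_le_ofReal ?_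
  have : 0 ≤ ∫ x, (f x - ∫ y, f y ∂μ) ^ 2 ∂μ := integral_nonneg fun x => sq_nonneg _
  linarith

section BlockMean

variable {ι X : Type*} [Fintype ι] [DecidableEq ι] [MeasurableSpace X] {m : ℕ} {lab : X → Fin m}
  {π : ι → Measure X} [∀ i, IsProbabilityMeasure (π i)]

/-- The conditional distribution of the product measure given that the labels are `σ`. -/
def blockProduct (π : ι → Measure X) (lab : X → Fin m) (σ : ι → Fin m) : Measure (ι → X) :=
  Measure.pi fun i => blockLaw (π i) lab (σ i)

/-- The conditional expectation of `f` given that the labels are `σ`. -/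
def blockMean (π : ι → Measure X) (lab : X → Fin m) (f : (ι → X) → ℝ) (σ : ι → Fin m) : ℝ :=
  ∫ θ, f θ ∂(blockProduct π lab σ)

omit [Fintype ι] [DecidableEq ι] in
lemma isProbabilityMeasure_blockLaw (h0 : ∀ i k, π i (lab ⁻¹' {k}) ≠ 0) (σ : ι → Fin m) (i : ι) :
    IsProbabilityMeasure (blockLaw (π i) lab (σ i)) :=
  (isMarkovKernel_blockLaw (h0 i)).isProbabilityMeasure _

lemma pi_eq_sum_blockProduct (hlab : Measurable lab) (h0 : ∀ i k, π i (lab ⁻¹' {k}) ≠ 0) :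
    Measure.pi π = ∑ σ : ι → Fin m, (∏ i, π i (lab ⁻¹' {σ i})) • blockProduct π lab σ := by
  have := isProbabilityMeasure_blockLaw h0
  refine Measure.pi_eq fun s hs => ?_
  simp only [Measure.finsetSum_apply, Measure.smul_apply, smul_eq_mul, blockProduct,
    Measure.pi_pi, ← Finset.prod_mul_distrib]
  simp_rw [← lintegral_blockLaw hlab (h0 _) (hs _)]
  rw [Finset.prod_univ_sum, Fintype.piFinset_univ]

omit [DecidableEq ι] in
lemma ae_blockProduct_label (hlab : Measurable lab) (h0 : ∀ i k, π i (lab ⁻¹' {k}) ≠ 0)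
    (σ : ι → Fin m) : ∀ᵐ θ ∂(blockProduct π lab σ), ∀ i, lab (θ i) = σ i := by
  have := isProbabilityMeasure_blockLaw h0
  rw [ae_all_iff]
  intro i
  have h : ∀ᵐ x ∂(blockLaw (π i) lab (σ i)), lab x = σ i :=
    ae_cond_mem (hlab (measurableSet_singleton (σ i)))
  exact (measurePreserving_eval (fun i => blockLaw (π i) lab (σ i)) i).quasiMeasurePreserving.ae h

/-- Efron–Stein within the blocks: the distance of `f` to its block averages is bounded by the
effect of resampling single coordinates within their blocks. -/
lemma lintegral_sqDist_blockMean_le (hlab : Measurable lab) (h0 : ∀ i k, π i (lab ⁻¹' {k}) ≠ 0)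
    {f : (ι → X) → ℝ} (hf : Measurable f) {M : ℝ} (hM : ∀ x, |f x| ≤ M) :
    ∫⁻ θ, sqDist (f θ) (blockMean π lab f fun i => lab (θ i)) ∂(Measure.pi π)
      ≤ ∑ i, ∫⁻ θ, ∫⁻ y, sqDist (f θ) (f (Function.update θ i y)) ∂(blockLaw (π i) lab (lab (θ i)))
        ∂(Measure.pi π) := by
  have := isProbabilityMeasure_blockLaw h0
  rw [pi_eq_sum_blockProduct hlab h0]
  simp only [lintegral_finsetSum_measure, lintegral_smul_measure, smul_eq_mul]
  rw [Finset.sum_comm]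
  refine Finset.sum_le_sum fun σ _ => ?_
  rw [← Finset.mul_sum]
  gcongr
  have hae := ae_blockProduct_label hlab h0 σ
  calc _ = ∫⁻ θ, sqDist (f θ) (∫ η, f η ∂(blockProduct π lab σ)) ∂(blockProduct π lab σ) := by
        refine lintegral_congr_ae ?_
        filter_upwards [hae] with θ hθ
        rw [show (fun i => lab (θ i)) = σ from funext hθ]
        rfl
    _ ≤ spread (blockProduct π lab σ) f := by
        have : IsProbabilityMeasure (blockProduct π lab σ) := by
          unfold blockProduct; infer_instance
        exact lintegral_sqDist_integral_le hf hM
    _ ≤ ∑ i, coordSpread (fun i => blockLaw (π i) lab (σ i)) i f := spread_pi_le _ hf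
    _ = _ := by
        refine Finset.sum_congr rfl fun i _ => lintegral_congr_ae ?_
        filter_upwards [hae] with θ hθ
        rw [hθ i]

omit [DecidableEq ι] in
lemma map_label_pi (hlab : Measurable lab) :
    (Measure.pi π).map (fun θ i => lab (θ i)) = Measure.pi fun i => (π i).map lab := by
  have : ∀ i, IsProbabilityMeasure ((π i).map lab) := fun i =>
    Measure.isProbabilityMeasure_map hlab.aemeasurable
  exact Measure.pi_map_pi fun i => hlab.aemeasurable

omit [DecidableEq ι] in
lemma lintegral_label_pi (hlab : Measurable lab) (G : (ι → Fin m) → ℝ≥0∞) :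
    ∫⁻ σ, G σ ∂(Measure.pi fun i => (π i).map lab)
      = ∫⁻ θ, G (fun i => lab (θ i)) ∂(Measure.pi π) := by
  rw [← map_label_pi hlab, lintegral_map Measurable.of_discrete (by fun_prop)]

/-- The effect of moving coordinate `i` by `κ` is the mean energy of the sections of `f` along `i`. -/
lemma lintegral_update_section (i : ι) {f : (ι → X) → ℝ} (hf : Measurable f) (κ : Kernel X X)
    [IsMarkovKernel κ] :
    ∫⁻ θ, ∫⁻ y, sqDist (f θ) (f (Function.update θ i y)) ∂(κ (θ i)) ∂(Measure.pi π)
      = ∫⁻ θ, energy κ (π i) (fun x => f (Function.update θ i x)) ∂(Measure.pi π) := by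
  rw [← lintegral_update π i (by fun_prop)]
  simp [energy]

lemma mul_lintegral_blockLaw_update_le (hlab : Measurable lab)
    (h0 : ∀ i k, π i (lab ⁻¹' {k}) ≠ 0) {P : Kernel X X} [IsMarkovKernel P] {i : ι}
    (hP : P.IsReversible (π i)) {γ : ℝ}
    (hγ : ∀ k, γ ≤ spectralGap (restrictTo P (lab ⁻¹' {k}) (hlab (measurableSet_singleton k)))
      (condOn (π i) (lab ⁻¹' {k})))
    {f : (ι → X) → ℝ} (hf : Measurable f) {M : ℝ} (hM : ∀ x, |f x| ≤ M) :
    ENNReal.ofReal γ * ∫⁻ θ, ∫⁻ y, sqDist (f θ) (f (Function.update θ i y))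
        ∂(blockLaw (π i) lab (lab (θ i))) ∂(Measure.pi π)
      ≤ ∫⁻ θ, ∫⁻ y, sqDist (f θ) (f (Function.update θ i y)) ∂(P (θ i)) ∂(Measure.pi π) := by
  have := isMarkovKernel_blockLaw (h0 i)
  rw [lintegral_update_section i hf P]
  have h1 := lintegral_update_section (π := π) i hf ((blockLaw (π i) lab).comap lab hlab)
  simp only [Kernel.comap_apply] at h1
  rw [h1, ← lintegral_const_mul' _ _ ENNReal.ofReal_ne_top]
  refine lintegral_mono fun θ => ?_
  exact mul_lintegral_blockLaw_le hlab hP (h0 i) hγ (by fun_prop) fun x => hM _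

/-- The gap of the projected chain bounds the effect of resampling coordinate `i` on the block
averages. -/
lemma mul_coordSpread_blockMean_le (hlab : Measurable lab)
    (h0 : ∀ i k, π i (lab ⁻¹' {k}) ≠ 0) {P : Kernel X X} [IsMarkovKernel P] {i : ι}
    (hP : P.Invariant (π i)) {f : (ι → X) → ℝ} (hf : Measurable f) (F : (ι → Fin m) → ℝ) :
    ENNReal.ofReal (spectralGap (projKernel P (π i) fun k => lab ⁻¹' {k}) ((π i).map lab)) *
        coordSpread (fun i => (π i).map lab) i F
      ≤ 3 * (∫⁻ θ, ∫⁻ y, sqDist (f θ) (f (Function.update θ i y)) ∂(P (θ i)) ∂(Measure.pi π)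
        + 2 * ∫⁻ θ, sqDist (f θ) (F fun i => lab (θ i)) ∂(Measure.pi π)) := by
  have hF : Measurable F := Measurable.of_discrete
  have : ∀ i, IsProbabilityMeasure ((π i).map lab) := fun i =>
    Measure.isProbabilityMeasure_map hlab.aemeasurable
  let E : (ι → X) → ℝ := fun θ => F fun i => lab (θ i)
  have hE : Measurable E := by fun_prop
  have hlu : ∀ θ x, (fun j => lab (Function.update θ i x j))
      = Function.update (fun j => lab (θ j)) i (lab x) := by
    intro θ x
    ext j
    by_cases hj : j = i
    · subst hj; simp
    · simp [hj]
  have h1 : coordSpread (fun i => (π i).map lab) i F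
      = ∫⁻ θ, spread ((π i).map lab) (fun k => F (Function.update (fun j => lab (θ j)) i k))
        ∂(Measure.pi π) := by
    unfold coordSpread
    rw [← lintegral_update _ i (by fun_prop), lintegral_label_pi hlab]
    simp [spread]
  have h2 : ENNReal.ofReal (spectralGap (projKernel P (π i) fun k => lab ⁻¹' {k}) ((π i).map lab)) *
        coordSpread (fun i => (π i).map lab) i F
      ≤ ∫⁻ θ, ∫⁻ y, sqDist (E θ) (E (Function.update θ i y)) ∂(P (θ i)) ∂(Measure.pi π) := by
    rw [h1, lintegral_update_section i hE P, ← lintegral_const_mul' _ _ ENNReal.ofReal_ne_top]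
    refine lintegral_mono fun θ => ?_
    refine (spectralGap_projKernel_mul_le hlab hP (h0 i) _).trans_eq ?_
    simp only [E, hlu]
  have h3 : ∫⁻ θ, ∫⁻ y, sqDist (f (Function.update θ i y)) (E (Function.update θ i y)) ∂(P (θ i))
        ∂(Measure.pi π) = ∫⁻ θ, sqDist (f θ) (E θ) ∂(Measure.pi π) := by
    rw [← lintegral_update π i (by fun_prop)]
    simp only [Function.update_self, Function.update_idem]
    rw [← lintegral_update π i (G := fun θ => sqDist (f θ) (E θ)) (by fun_prop)]
    refine lintegral_congr fun θ => ?_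
    exact lintegral_lintegral_of_invariant hP
      (g := fun x => sqDist (f (Function.update θ i x)) (E (Function.update θ i x))) (by fun_prop)
  refine h2.trans ?_
  calc _ ≤ ∫⁻ θ, ∫⁻ y, 3 * (sqDist (E θ) (f θ) + sqDist (f θ) (f (Function.update θ i y))
        + sqDist (f (Function.update θ i y)) (E (Function.update θ i y))) ∂(P (θ i))
          ∂(Measure.pi π) :=
        lintegral_mono fun θ => lintegral_mono fun y => sqDist_triangle_three _ _ _ _
    _ = 3 * (∫⁻ θ, sqDist (E θ) (f θ) ∂(Measure.pi π)
        + ∫⁻ θ, ∫⁻ y, sqDist (f θ) (f (Function.update θ i y)) ∂(P (θ i)) ∂(Measure.pi π)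
        + ∫⁻ θ, sqDist (f θ) (E θ) ∂(Measure.pi π)) := by
        rw [← h3, ← lintegral_add_left (by fun_prop), ← lintegral_add_left (by fun_prop),
          ← lintegral_const_mul' _ _ (by norm_num)]
        refine lintegral_congr fun θ => ?_
        rw [lintegral_const_mul' _ _ (by norm_num), lintegral_add_left (by fun_prop),
          lintegral_add_left (by fun_prop)]
        simp
    _ = _ := by
        simp_rw [sqDist_comm (E _) (f _)]
        change _ = 3 * (_ + 2 * ∫⁻ θ, sqDist (f θ) (E θ) ∂(Measure.pi π))
        ring

end BlockMean

/-! ### The swap move -/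

section Accept

variable {X : Type*} [MeasurableSpace X]

/-- The acceptance probability for exchanging states `x` and `y` of levels with densities `u` and
`v`. -/
def pairAccept (u v : X → ℝ≥0) (x y : X) : ℝ≥0 := min 1 (u y * v x / (u x * v y))

omit [MeasurableSpace X] in
/-- Where the acceptance ratio is a division by zero, both sides vanish. -/
lemma le_pairAccept (u v : X → ℝ≥0) (x y : X) :
    min 1 (v x / u x) * min 1 (u y / v y) ≤ pairAccept u v x y := by
  refine le_min (mul_le_one' (min_le_left _ _) (min_le_left _ _)) ?_
  refine (mul_le_mul' (min_le_right _ _) (min_le_right _ _)).trans_eq ?_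
  rw [div_mul_div_comm, mul_comm (v x)]

omit [MeasurableSpace X] in
lemma pairAccept_mul (u v : X → ℝ≥0) {x : X} (hx : u x ≠ 0) (y : X) :
    v y * pairAccept u v x y = u y * min (v x / u x) (v y / u y) := by
  unfold pairAccept
  by_cases hu : u y = 0
  · simp [hu]
  by_cases hv : v y = 0
  · simp [hv]
  rw [mul_min, mul_min, mul_one, min_comm]
  congr 1 <;> field_simp

variable {ν : Measure X} {u v : X → ℝ≥0}

/-- Detailed balance of the swap. Both sides are written as integrals against the square of the
first measure: wherever a swap can be accepted, the second one has density `v / u` relative to it,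
and the flow of accepted swaps has the symmetric density `min (v x / u x) (v y / u y)`. This avoids
Tonelli's theorem for `ν`, which need not be s-finite. -/
lemma lintegral_pairAccept_swap (hu : Measurable u) (hv : Measurable v)
    [SFinite (ν.withDensity fun x => (u x : ℝ≥0∞))] {H : X → X → ℝ≥0∞}
    (hH : Measurable fun z : X × X => H z.1 z.2) :
    ∫⁻ x, ∫⁻ y, pairAccept u v x y * H y x ∂(ν.withDensity fun x => (v x : ℝ≥0∞))
        ∂(ν.withDensity fun x => (u x : ℝ≥0∞))
      = ∫⁻ x, ∫⁻ y, pairAccept u v x y * H x y ∂(ν.withDensity fun x => (v x : ℝ≥0∞))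
        ∂(ν.withDensity fun x => (u x : ℝ≥0∞)) := by
  have key : ∀ G : X → X → ℝ≥0∞, Measurable (fun z : X × X => G z.1 z.2) →
      ∫⁻ x, ∫⁻ y, pairAccept u v x y * G x y ∂(ν.withDensity fun x => (v x : ℝ≥0∞))
        ∂(ν.withDensity fun x => (u x : ℝ≥0∞))
      = ∫⁻ x, ∫⁻ y, (min (v x / u x) (v y / u y) : ℝ≥0) * G x y
        ∂(ν.withDensity fun x => (u x : ℝ≥0∞)) ∂(ν.withDensity fun x => (u x : ℝ≥0∞)) := by
    intro G hG
    have hae : ∀ᵐ x ∂(ν.withDensity fun x => (u x : ℝ≥0∞)), u x ≠ 0 := by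
      rw [ae_withDensity_iff (by fun_prop)]
      exact Filter.Eventually.of_forall fun x hx => by simpa using hx
    refine lintegral_congr_ae ?_
    filter_upwards [hae] with x hx
    have hm : Measurable fun y => pairAccept u v x y := by
      unfold pairAccept
      fun_prop
    rw [lintegral_withDensity_eq_lintegral_mul _ (by fun_prop) (by fun_prop),
      lintegral_withDensity_eq_lintegral_mul _ (by fun_prop) (by fun_prop)]
    refine lintegral_congr fun y => ?_
    simp only [Pi.mul_apply, ← mul_assoc]
    congr 1
    exact_mod_cast pairAccept_mul u v hx y
  rw [key _ (by fun_prop), key _ (by fun_prop), lintegral_lintegral_swap (by fun_prop)]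
  simp_rw [min_comm]

variable {m : ℕ} {lab : X → Fin m}

/-- The overlap bounds from below the conditional mean of `min 1 (v / u)` given the label. -/
lemma mul_lintegral_label_le (hlab : Measurable lab) (hu : Measurable u) (hv : Measurable v)
    {φ : ℝ≥0∞} (hφ : ∀ k, φ * (ν.withDensity fun x => (u x : ℝ≥0∞)) (lab ⁻¹' {k})
      ≤ ∫⁻ x in lab ⁻¹' {k}, (min (u x) (v x) : ℝ≥0) ∂ν) (G : Fin m → ℝ≥0∞) :
    φ * ∫⁻ x, G (lab x) ∂(ν.withDensity fun x => (u x : ℝ≥0∞))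
      ≤ ∫⁻ x, (min 1 (v x / u x) : ℝ≥0) * G (lab x) ∂(ν.withDensity fun x => (u x : ℝ≥0∞)) := by
  rw [lintegral_eq_sum_blocks hlab, lintegral_eq_sum_blocks hlab, Finset.mul_sum]
  refine Finset.sum_le_sum fun k _ => ?_
  have hk : MeasurableSet (lab ⁻¹' {k}) := hlab (measurableSet_singleton k)
  have h1 : ∫⁻ x in lab ⁻¹' {k}, G (lab x) ∂(ν.withDensity fun x => (u x : ℝ≥0∞))
      = G k * (ν.withDensity fun x => (u x : ℝ≥0∞)) (lab ⁻¹' {k}) := by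
    rw [← setLIntegral_const]
    exact setLIntegral_congr_fun hk fun x hx => by rw [show lab x = k from hx]
  have h2 : ∫⁻ x in lab ⁻¹' {k}, (min 1 (v x / u x) : ℝ≥0) * G (lab x)
        ∂(ν.withDensity fun x => (u x : ℝ≥0∞))
      = G k * ∫⁻ x in lab ⁻¹' {k}, (min 1 (v x / u x) : ℝ≥0)
        ∂(ν.withDensity fun x => (u x : ℝ≥0∞)) := by
    rw [← lintegral_const_mul _ (by fun_prop)]
    exact setLIntegral_congr_fun hk fun x hx => by
      simp only [show lab x = k from hx]; rw [mul_comm]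
  rw [h1, h2, mul_left_comm]
  gcongr
  refine (hφ k).trans ?_
  rw [restrict_withDensity hk, lintegral_withDensity_eq_lintegral_mul _ (by fun_prop) (by fun_prop)]
  refine lintegral_mono fun x => ?_
  simp only [Pi.mul_apply]
  norm_cast
  by_cases hx : u x = 0
  · simp [hx]
  · rw [mul_min, mul_one, mul_div_cancel₀ _ hx]

end Accept

section Swap

variable {X : Type*} [MeasurableSpace X] {L : ℕ} {ν : Measure X} {p : Fin (L + 1) → X → ℝ≥0}
  {l : Fin L}

@[fun_prop]
lemma measurable_swapAccept (hp : ∀ i, Measurable (p i)) : Measurable (swapAccept p l) := by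
  unfold swapAccept
  have := hp l.castSucc
  have := hp l.succ
  fun_prop

omit [MeasurableSpace X] in
lemma swapAccept_le_one (θ : Fin (L + 1) → X) : swapAccept p l θ ≤ 1 := min_le_left _ _

omit [MeasurableSpace X] in
lemma swapAccept_update (θ : Fin (L + 1) → X) (x y : X) :
    swapAccept p l (Function.update (Function.update θ l.castSucc x) l.succ y)
      = pairAccept (p l.castSucc) (p l.succ) x y := by
  have hne : l.castSucc ≠ l.succ := Fin.castSucc_lt_succ.ne
  simp [swapAccept, pairAccept, hne]

variable [∀ i, IsProbabilityMeasure (level ν p i)]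

/-- Resampling two adjacent levels leaves the stationary distribution invariant. -/
lemma lintegral_update_adjacent (l : Fin L) {G : (Fin (L + 1) → X) → ℝ≥0∞} (hG : Measurable G) :
    ∫⁻ θ, ∫⁻ x, ∫⁻ y, G (Function.update (Function.update θ l.castSucc x) l.succ y)
        ∂(level ν p l.succ) ∂(level ν p l.castSucc) ∂(ptMeasure ν p)
      = ∫⁻ θ, G θ ∂(ptMeasure ν p) := by
  exact (lintegral_update (level ν p) l.castSucc (G := fun θ =>
    ∫⁻ y, G (Function.update θ l.succ y) ∂(level ν p l.succ)) (by fun_prop)).trans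
    (lintegral_update (level ν p) l.succ hG)

/-- Detailed balance for the swap of two adjacent levels. -/
lemma lintegral_swapAccept_swapLevels (hp : ∀ i, Measurable (p i))
    {G : (Fin (L + 1) → X) → ℝ≥0∞} (hG : Measurable G) :
    ∫⁻ θ, swapAccept p l θ * G (swapLevels l θ) ∂(ptMeasure ν p)
      = ∫⁻ θ, swapAccept p l θ * G θ ∂(ptMeasure ν p) := by
  have := measurable_swapAccept (l := l) hp
  rw [← lintegral_update_adjacent l (G := fun θ => swapAccept p l θ * G (swapLevels l θ))
    (by fun_prop), ← lintegral_update_adjacent l (G := fun θ => swapAccept p l θ * G θ)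
    (by fun_prop)]
  refine lintegral_congr fun θ => ?_
  simp_rw [swapAccept_update, swapLevels_update]
  have : IsProbabilityMeasure (ν.withDensity fun x => (p l.castSucc x : ℝ≥0∞)) :=
    inferInstanceAs (IsProbabilityMeasure (level ν p l.castSucc))
  exact lintegral_pairAccept_swap (ν := ν) (hp l.castSucc) (hp l.succ)
    (H := fun x y => G (Function.update (Function.update θ l.castSucc x) l.succ y)) (by fun_prop)

variable {m : ℕ} {lab : X → Fin m}

/-- Given the labels, a swap is accepted with probability at least the square of the overlap. -/
lemma sq_mul_lintegral_label_le (hlab : Measurable lab) (hp : ∀ i, Measurable (p i))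
    {φ : ℝ≥0∞} (hφt : φ ≠ ∞)
    (hφ : ∀ k, φ * level ν p l.castSucc (lab ⁻¹' {k})
      ≤ ∫⁻ x in lab ⁻¹' {k}, (min (p l.castSucc x) (p l.succ x) : ℝ≥0) ∂ν)
    (hφ' : ∀ k, φ * level ν p l.succ (lab ⁻¹' {k})
      ≤ ∫⁻ x in lab ⁻¹' {k}, (min (p l.succ x) (p l.castSucc x) : ℝ≥0) ∂ν)
    (G : (Fin (L + 1) → Fin m) → ℝ≥0∞) :
    φ ^ 2 * ∫⁻ θ, G (fun i => lab (θ i)) ∂(ptMeasure ν p)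
      ≤ ∫⁻ θ, swapAccept p l θ * G (fun i => lab (θ i)) ∂(ptMeasure ν p) := by
  have hG : Measurable G := Measurable.of_discrete
  have := measurable_swapAccept (l := l) hp
  have := hp l.castSucc
  have := hp l.succ
  have hlu : ∀ (θ : Fin (L + 1) → X) i x, (fun j => lab (Function.update θ i x j))
      = Function.update (fun j => lab (θ j)) i (lab x) := by
    intro θ i x
    ext j
    by_cases hj : j = i
    · subst hj; simp
    · simp [hj]
  rw [← lintegral_update_adjacent l (G := fun θ => G fun i => lab (θ i)) (by fun_prop),
    ← lintegral_update_adjacent l (G := fun θ => swapAccept p l θ * G fun i => lab (θ i))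
      (by fun_prop), ← lintegral_const_mul' _ _ (ENNReal.pow_ne_top hφt)]
  refine lintegral_mono fun θ => ?_
  simp_rw [swapAccept_update, hlu]
  set T : Fin m → Fin m → ℝ≥0∞ := fun a b =>
    G (Function.update (Function.update (fun j => lab (θ j)) l.castSucc a) l.succ b)
  calc φ ^ 2 * ∫⁻ x, ∫⁻ y, T (lab x) (lab y) ∂(level ν p l.succ) ∂(level ν p l.castSucc)
      = φ * ∫⁻ x, φ * ∫⁻ y, T (lab x) (lab y) ∂(level ν p l.succ) ∂(level ν p l.castSucc) := by
        rw [lintegral_const_mul' _ _ hφt, ← mul_assoc, sq]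
    _ ≤ φ * ∫⁻ x, ∫⁻ y, (min 1 (p l.castSucc y / p l.succ y) : ℝ≥0) * T (lab x) (lab y)
          ∂(level ν p l.succ) ∂(level ν p l.castSucc) := by
        gcongr with x
        exact mul_lintegral_label_le hlab (hp _) (hp _) hφ' _
    _ ≤ ∫⁻ x, (min 1 (p l.succ x / p l.castSucc x) : ℝ≥0) *
          ∫⁻ y, (min 1 (p l.castSucc y / p l.succ y) : ℝ≥0) * T (lab x) (lab y)
          ∂(level ν p l.succ) ∂(level ν p l.castSucc) :=
        mul_lintegral_label_le hlab (hp _) (hp _) hφ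
          (fun a => ∫⁻ y, (min 1 (p l.castSucc y / p l.succ y) : ℝ≥0) * T a (lab y)
          ∂(level ν p l.succ))
    _ ≤ _ := by
        refine lintegral_mono fun x => ?_
        rw [← lintegral_const_mul' _ _ ENNReal.coe_ne_top]
        refine lintegral_mono fun y => ?_
        rw [← mul_assoc]
        gcongr
        rw [← ENNReal.coe_mul]
        exact ENNReal.coe_le_coe.2 (le_pairAccept _ _ x y)

/-- Swaps of the block averages at stationarity are bounded by the accepted swaps of `f`. -/
lemma sq_mul_lintegral_swapLevels_le (hlab : Measurable lab) (hp : ∀ i, Measurable (p i))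
    {φ : ℝ≥0∞} (hφt : φ ≠ ∞)
    (hφ : ∀ k, φ * level ν p l.castSucc (lab ⁻¹' {k})
      ≤ ∫⁻ x in lab ⁻¹' {k}, (min (p l.castSucc x) (p l.succ x) : ℝ≥0) ∂ν)
    (hφ' : ∀ k, φ * level ν p l.succ (lab ⁻¹' {k})
      ≤ ∫⁻ x in lab ⁻¹' {k}, (min (p l.succ x) (p l.castSucc x) : ℝ≥0) ∂ν)
    {f : (Fin (L + 1) → X) → ℝ} (hf : Measurable f) (F : (Fin (L + 1) → Fin m) → ℝ) :
    φ ^ 2 * ∫⁻ σ, sqDist (F σ) (F (swapLevels l σ)) ∂(Measure.pi fun i => (level ν p i).map lab)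
      ≤ 3 * (∫⁻ θ, swapAccept p l θ * sqDist (f θ) (f (swapLevels l θ)) ∂(ptMeasure ν p)
        + 2 * ∫⁻ θ, sqDist (f θ) (F fun i => lab (θ i)) ∂(ptMeasure ν p)) := by
  have hF : Measurable F := Measurable.of_discrete
  have := measurable_swapAccept (l := l) hp
  let E : (Fin (L + 1) → X) → ℝ := fun θ => F fun i => lab (θ i)
  have hE : Measurable E := by fun_prop
  let N := ∫⁻ θ, sqDist (f θ) (E θ) ∂(ptMeasure ν p)
  have h1 : ∫⁻ θ, swapAccept p l θ * sqDist (f θ) (E θ) ∂(ptMeasure ν p) ≤ N := by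
    refine lintegral_mono fun θ => ?_
    calc _ ≤ 1 * sqDist (f θ) (E θ) := by
          gcongr
          exact_mod_cast swapAccept_le_one θ
      _ = _ := one_mul _
  have h2 : ∫⁻ θ, swapAccept p l θ * sqDist (f (swapLevels l θ)) (E (swapLevels l θ))
      ∂(ptMeasure ν p) ≤ N :=
    (lintegral_swapAccept_swapLevels hp (G := fun θ => sqDist (f θ) (E θ)) (by fun_prop)).trans_le
      h1
  rw [lintegral_label_pi hlab]
  refine (sq_mul_lintegral_label_le hlab hp hφt hφ hφ'
    (fun σ => sqDist (F σ) (F (swapLevels l σ)))).trans ?_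
  calc ∫⁻ θ, swapAccept p l θ * sqDist (E θ) (E (swapLevels l θ)) ∂(ptMeasure ν p)
      ≤ ∫⁻ θ, 3 * (swapAccept p l θ * sqDist (f θ) (E θ)
          + swapAccept p l θ * sqDist (f θ) (f (swapLevels l θ))
          + swapAccept p l θ * sqDist (f (swapLevels l θ)) (E (swapLevels l θ)))
          ∂(ptMeasure ν p) := by
        refine lintegral_mono fun θ => ?_
        rw [sqDist_comm (f θ) (E θ)]
        calc _ ≤ swapAccept p l θ * (3 * (sqDist (E θ) (f θ) + sqDist (f θ) (f (swapLevels l θ))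
              + sqDist (f (swapLevels l θ)) (E (swapLevels l θ)))) := by
              gcongr
              exact sqDist_triangle_three _ _ _ _
          _ = _ := by ring
    _ = 3 * (∫⁻ θ, swapAccept p l θ * sqDist (f θ) (E θ) ∂(ptMeasure ν p)
          + ∫⁻ θ, swapAccept p l θ * sqDist (f θ) (f (swapLevels l θ)) ∂(ptMeasure ν p)
          + ∫⁻ θ, swapAccept p l θ * sqDist (f (swapLevels l θ)) (E (swapLevels l θ))
          ∂(ptMeasure ν p)) := by
        rw [lintegral_const_mul' _ _ (by norm_num), lintegral_add_left (by fun_prop),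
          lintegral_add_left (by fun_prop)]
    _ ≤ 3 * (N + ∫⁻ θ, swapAccept p l θ * sqDist (f θ) (f (swapLevels l θ)) ∂(ptMeasure ν p)
          + N) := by gcongr
    _ = _ := by
        change _ = 3 * (_ + 2 * N)
        ring

end Swap

/-! ### The parallel tempering kernel -/

section Chain

variable {X : Type*} [MeasurableSpace X] {L : ℕ} {ν : Measure X} {p : Fin (L + 1) → X → ℝ≥0}
  (hp : ∀ i, Measurable (p i)) (T : Fin (L + 1) → Kernel X X) [∀ i, IsMarkovKernel (T i)]

lemma lintegral_updateKernel (θ : Fin (L + 1) → X) {g : (Fin (L + 1) → X) → ℝ≥0∞}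
    (hg : Measurable g) :
    ∫⁻ η, g η ∂(updateKernel T θ) = 2⁻¹ * g θ + (2 * ((L : ℝ≥0∞) + 1))⁻¹ *
      ∑ i, ∫⁻ y, g (Function.update θ i y) ∂(T i (θ i)) := by
  change ∫⁻ η, g η ∂((2 : ℝ≥0∞)⁻¹ • Measure.dirac θ +
    (2 * ((L : ℝ≥0∞) + 1))⁻¹ • ∑ i, (T i (θ i)).map (Function.update θ i)) = _
  rw [lintegral_add_measure, lintegral_smul_measure, lintegral_smul_measure,
    lintegral_dirac' _ hg, lintegral_finsetSum_measure]
  simp_rw [lintegral_map hg (measurable_update θ), smul_eq_mul]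

lemma lintegral_swapKernel (θ : Fin (L + 1) → X) {g : (Fin (L + 1) → X) → ℝ≥0∞}
    (hg : Measurable g) :
    ∫⁻ η, g η ∂(swapKernel p hp θ)
      = ∑ l : Fin L, (2 * (L : ℝ≥0∞))⁻¹ * swapAccept p l θ * g (swapLevels l θ)
        + (1 - ∑ l : Fin L, (2 * (L : ℝ≥0∞))⁻¹ * swapAccept p l θ) * g θ := by
  change ∫⁻ η, g η ∂(∑ l : Fin L, ((2 * (L : ℝ≥0∞))⁻¹ * swapAccept p l θ) •
    Measure.dirac (swapLevels l θ)
    + (1 - ∑ l : Fin L, (2 * (L : ℝ≥0∞))⁻¹ * swapAccept p l θ) • Measure.dirac θ) = _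
  rw [lintegral_add_measure, lintegral_finsetSum_measure]
  simp_rw [lintegral_smul_measure, lintegral_dirac' _ hg, smul_eq_mul]

omit [MeasurableSpace X] in
lemma sum_swapAccept_le (θ : Fin (L + 1) → X) :
    ∑ l : Fin L, (2 * (L : ℝ≥0∞))⁻¹ * swapAccept p l θ ≤ 2⁻¹ := by
  calc _ ≤ ∑ l : Fin L, (2 * (L : ℝ≥0∞))⁻¹ * 1 := by
        gcongr with l
        exact_mod_cast swapAccept_le_one θ
    _ = 2⁻¹ * ((L : ℝ≥0∞) * (L : ℝ≥0∞)⁻¹) := by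
        rw [ENNReal.mul_inv (by simp) (by simp)]
        simp
        ring
    _ ≤ 2⁻¹ * 1 := by gcongr; exact ENNReal.mul_inv_le_one _
    _ = 2⁻¹ := mul_one _

lemma half_le_of_le_half {a : ℝ≥0∞} (h : a ≤ 2⁻¹) : 2⁻¹ ≤ 1 - a := by
  calc (2⁻¹ : ℝ≥0∞) = 1 - 2⁻¹ := ENNReal.one_sub_inv_two.symm
    _ ≤ 1 - a := tsub_le_tsub_left h 1

/-- The swap move holds with probability at least one half. -/
lemma half_mul_le_lintegral_swapKernel (θ : Fin (L + 1) → X) {g : (Fin (L + 1) → X) → ℝ≥0∞}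
    (hg : Measurable g) : 2⁻¹ * g θ ≤ ∫⁻ η, g η ∂(swapKernel p hp θ) := by
  rw [lintegral_swapKernel hp θ hg]
  refine le_trans ?_ le_add_self
  gcongr
  exact half_le_of_le_half (sum_swapAccept_le θ)

lemma half_mul_le_lintegral_updateKernel (θ : Fin (L + 1) → X) {g : (Fin (L + 1) → X) → ℝ≥0∞}
    (hg : Measurable g) : 2⁻¹ * g θ ≤ ∫⁻ η, g η ∂(updateKernel T θ) := by
  rw [lintegral_updateKernel T θ hg]
  exact le_self_add

instance isMarkovKernel_swapKernel : IsMarkovKernel (swapKernel p hp) := by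
  refine ⟨fun θ => ⟨?_⟩⟩
  have := lintegral_swapKernel hp θ (g := fun _ => 1) measurable_const
  simp only [lintegral_const, one_mul, mul_one] at this
  rw [this, add_tsub_cancel_of_le]
  exact (sum_swapAccept_le θ).trans (by simp)

instance isMarkovKernel_updateKernel : IsMarkovKernel (updateKernel T) := by
  refine ⟨fun θ => ⟨?_⟩⟩
  have := lintegral_updateKernel T θ (g := fun _ => 1) measurable_const
  simp only [lintegral_const, one_mul, mul_one, measure_univ, Finset.sum_const, Finset.card_univ,
    Fintype.card_fin, nsmul_eq_mul, Nat.cast_add, Nat.cast_one] at this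
  rw [this, ENNReal.mul_inv (by simp) (by simp), mul_assoc,
    ENNReal.inv_mul_cancel (by simp) (by finiteness), mul_one, ENNReal.inv_two_add_inv_two]

instance isMarkovKernel_ptKernel : IsMarkovKernel (ptKernel p hp T) := by
  unfold ptKernel
  infer_instance

variable [∀ i, IsProbabilityMeasure (level ν p i)]

instance isProbabilityMeasure_ptMeasure : IsProbabilityMeasure (ptMeasure ν p) := by
  unfold ptMeasure
  infer_instance

lemma invariant_of_lintegral {Ω : Type*} [MeasurableSpace Ω] {P : Kernel Ω Ω} {μ : Measure Ω}
    (h : ∀ g : Ω → ℝ≥0∞, Measurable g → ∫⁻ x, ∫⁻ y, g y ∂(P x) ∂μ = ∫⁻ x, g x ∂μ) :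
    P.Invariant μ := by
  refine Measure.ext fun s hs => ?_
  rw [Measure.bind_apply hs (Kernel.aemeasurable _), ← lintegral_indicator_one hs,
    ← h _ (measurable_one.indicator hs)]
  simp_rw [lintegral_indicator_one hs]

lemma invariant_swapKernel : (swapKernel p hp).Invariant (ptMeasure ν p) := by
  refine invariant_of_lintegral fun g hg => ?_
  have ha : ∀ l : Fin L, Measurable (swapAccept p l) := fun l => measurable_swapAccept hp
  simp_rw [lintegral_swapKernel hp _ hg]
  rw [lintegral_add_left (by fun_prop), lintegral_finsetSum _ (fun l _ => by fun_prop)]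
  simp_rw [mul_assoc]
  have h1 : ∀ l : Fin L, ∫⁻ θ, (2 * (L : ℝ≥0∞))⁻¹ * (swapAccept p l θ * g (swapLevels l θ))
        ∂(ptMeasure ν p)
      = ∫⁻ θ, (2 * (L : ℝ≥0∞))⁻¹ * (swapAccept p l θ * g θ) ∂(ptMeasure ν p) := by
    intro l
    rw [lintegral_const_mul _ (by fun_prop), lintegral_const_mul _ (by fun_prop),
      lintegral_swapAccept_swapLevels hp hg]
  simp_rw [h1]
  rw [← lintegral_finsetSum _ (fun l _ => by fun_prop), ← lintegral_add_left (by fun_prop)]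
  refine lintegral_congr fun θ => ?_
  simp_rw [← mul_assoc]
  rw [← Finset.sum_mul, ← add_mul, add_tsub_cancel_of_le, one_mul]
  exact (sum_swapAccept_le θ).trans (by simp)

lemma lintegral_update_of_invariant {i : Fin (L + 1)} (hT : (T i).Invariant (level ν p i))
    {g : (Fin (L + 1) → X) → ℝ≥0∞} (hg : Measurable g) :
    ∫⁻ θ, ∫⁻ y, g (Function.update θ i y) ∂(T i (θ i)) ∂(ptMeasure ν p)
      = ∫⁻ θ, g θ ∂(ptMeasure ν p) := by
  unfold ptMeasure
  rw [← lintegral_update (level ν p) i hg, ← lintegral_update (level ν p) i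
    (G := fun θ => ∫⁻ y, g (Function.update θ i y) ∂(T i (θ i))) (by fun_prop)]
  refine lintegral_congr fun θ => ?_
  simp only [Function.update_self, Function.update_idem]
  exact lintegral_lintegral_of_invariant hT (g := fun x => g (Function.update θ i x)) (by fun_prop)

lemma invariant_updateKernel (hT : ∀ i, (T i).Invariant (level ν p i)) :
    (updateKernel T).Invariant (ptMeasure ν p) := by
  refine invariant_of_lintegral fun g hg => ?_
  simp_rw [lintegral_updateKernel T _ hg]
  rw [lintegral_add_left (by fun_prop), lintegral_const_mul _ hg,
    lintegral_const_mul _ (Finset.measurable_fun_sum _ fun i _ => by fun_prop),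
    lintegral_finsetSum _ (fun i _ => by fun_prop)]
  simp_rw [lintegral_update_of_invariant T (hT _) hg]
  rw [Finset.sum_const, Finset.card_univ, Fintype.card_fin, nsmul_eq_mul, Nat.cast_add,
    Nat.cast_one, ENNReal.mul_inv (by simp) (by simp), ← mul_assoc, mul_assoc (2⁻¹),
    ENNReal.inv_mul_cancel (by simp) (by finiteness), mul_one, ← add_mul,
    ENNReal.inv_two_add_inv_two, one_mul]

lemma invariant_ptKernel (hT : ∀ i, (T i).Invariant (level ν p i)) :
    (ptKernel p hp T).Invariant (ptMeasure ν p) :=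
  ((invariant_swapKernel hp).comp (invariant_updateKernel T hT)).comp (invariant_swapKernel hp)

lemma lintegral_ptKernel (θ : Fin (L + 1) → X) {g : (Fin (L + 1) → X) → ℝ≥0∞}
    (hg : Measurable g) :
    ∫⁻ η, g η ∂(ptKernel p hp T θ) = ∫⁻ η, ∫⁻ ζ, ∫⁻ ξ, g ξ ∂(swapKernel p hp ζ)
      ∂(updateKernel T η) ∂(swapKernel p hp θ) := by
  unfold ptKernel
  rw [Kernel.lintegral_comp _ _ _ hg]
  simp_rw [Kernel.lintegral_comp _ _ _ hg]

omit [∀ i, IsProbabilityMeasure (level ν p i)] in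
/-- Four times the parallel tempering kernel dominates the update kernel, since both swap moves
hold with probability at least one half. -/
lemma lintegral_updateKernel_le (θ : Fin (L + 1) → X)
    {g : (Fin (L + 1) → X) → ℝ≥0∞} (hg : Measurable g) :
    2⁻¹ * (2⁻¹ * ∫⁻ η, g η ∂(updateKernel T θ)) ≤ ∫⁻ η, g η ∂(ptKernel p hp T θ) := by
  rw [lintegral_ptKernel hp T θ hg]
  refine le_trans ?_ (half_mul_le_lintegral_swapKernel hp θ (by fun_prop))
  gcongr
  rw [← lintegral_const_mul' _ _ (by simp)]
  exact lintegral_mono fun η => half_mul_le_lintegral_swapKernel hp η hg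

/-- Four times the parallel tempering kernel dominates the swap kernel, since the update and the
second swap move hold with probability at least one half. -/
lemma lintegral_swapKernel_le (θ : Fin (L + 1) → X)
    {g : (Fin (L + 1) → X) → ℝ≥0∞} (hg : Measurable g) :
    2⁻¹ * (2⁻¹ * ∫⁻ η, g η ∂(swapKernel p hp θ)) ≤ ∫⁻ η, g η ∂(ptKernel p hp T θ) := by
  rw [lintegral_ptKernel hp T θ hg, ← lintegral_const_mul' _ _ (by simp),
    ← lintegral_const_mul' _ _ (by simp)]
  refine lintegral_mono fun η => ?_
  refine le_trans ?_ (half_mul_le_lintegral_updateKernel T η (by fun_prop))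
  gcongr
  exact half_mul_le_lintegral_swapKernel hp η hg

lemma energy_le_four_mul_of_le {Ω : Type*} [MeasurableSpace Ω] {P R : Kernel Ω Ω} {μ : Measure Ω}
    (h : ∀ x, ∀ g : Ω → ℝ≥0∞, Measurable g →
      2⁻¹ * (2⁻¹ * ∫⁻ y, g y ∂(R x)) ≤ ∫⁻ y, g y ∂(P x))
    {f : Ω → ℝ} (hf : Measurable f) : energy R μ f ≤ 4 * energy P μ f := by
  unfold energy
  rw [← lintegral_const_mul' _ _ (by norm_num)]
  refine lintegral_mono fun x => ?_
  have h1 := h x (fun y => sqDist (f x) (f y)) (by fun_prop)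
  calc ∫⁻ y, sqDist (f x) (f y) ∂(R x)
      = (2 * 2⁻¹) * (2 * 2⁻¹) * ∫⁻ y, sqDist (f x) (f y) ∂(R x) := by
        simp [ENNReal.mul_inv_cancel]
    _ = 4 * (2⁻¹ * (2⁻¹ * ∫⁻ y, sqDist (f x) (f y) ∂(R x))) := by ring
    _ ≤ _ := by gcongr

omit [∀ i, IsProbabilityMeasure (level ν p i)] in
lemma sum_update_le_energy (μ : Measure (Fin (L + 1) → X)) {f : (Fin (L + 1) → X) → ℝ}
    (hf : Measurable f) :
    ∑ i, ∫⁻ θ, ∫⁻ y, sqDist (f θ) (f (Function.update θ i y)) ∂(T i (θ i)) ∂μ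
      ≤ 8 * ((L : ℝ≥0∞) + 1) * energy (ptKernel p hp T) μ f := by
  have h1 : energy (updateKernel T) μ f = (2 * ((L : ℝ≥0∞) + 1))⁻¹ *
      ∑ i, ∫⁻ θ, ∫⁻ y, sqDist (f θ) (f (Function.update θ i y)) ∂(T i (θ i)) ∂μ := by
    unfold energy
    rw [← lintegral_finsetSum _ (fun i _ => by fun_prop), ← lintegral_const_mul' _ _ (by simp)]
    refine lintegral_congr fun θ => ?_
    rw [lintegral_updateKernel T θ (by fun_prop), sqDist_self, mul_zero, zero_add]
  have h2 := energy_le_four_mul_of_le (μ := μ)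
    (fun θ g hg => lintegral_updateKernel_le hp T θ hg) hf
  rw [h1] at h2
  calc _ = (2 * ((L : ℝ≥0∞) + 1)) * ((2 * ((L : ℝ≥0∞) + 1))⁻¹ *
      ∑ i, ∫⁻ θ, ∫⁻ y, sqDist (f θ) (f (Function.update θ i y)) ∂(T i (θ i)) ∂μ) := by
        rw [← mul_assoc, ENNReal.mul_inv_cancel (by simp) (by finiteness), one_mul]
    _ ≤ (2 * ((L : ℝ≥0∞) + 1)) * (4 * energy (ptKernel p hp T) μ f) := by gcongr
    _ = _ := by ring

omit [∀ i, IsProbabilityMeasure (level ν p i)] in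
lemma swap_le_energy (μ : Measure (Fin (L + 1) → X)) {f : (Fin (L + 1) → X) → ℝ}
    (hf : Measurable f) (l : Fin L) :
    ∫⁻ θ, swapAccept p l θ * sqDist (f θ) (f (swapLevels l θ)) ∂μ
      ≤ 8 * ((L : ℝ≥0∞) + 1) * energy (ptKernel p hp T) μ f := by
  have hL : (L : ℝ≥0∞) ≠ 0 := by
    have := l.pos
    exact_mod_cast this.ne'
  have h1 : (2 * (L : ℝ≥0∞))⁻¹ * ∫⁻ θ, swapAccept p l θ * sqDist (f θ) (f (swapLevels l θ)) ∂μ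
      ≤ energy (swapKernel p hp) μ f := by
    unfold energy
    rw [← lintegral_const_mul' _ _ (by simp [hL])]
    refine lintegral_mono fun θ => ?_
    rw [lintegral_swapKernel hp θ (by fun_prop), ← mul_assoc]
    exact (Finset.single_le_sum (f := fun l : Fin L => (2 * (L : ℝ≥0∞))⁻¹ * swapAccept p l θ *
      sqDist (f θ) (f (swapLevels l θ))) (fun _ _ => zero_le) (Finset.mem_univ l)).trans
      le_self_add
  have h2 := energy_le_four_mul_of_le (μ := μ)
    (fun θ g hg => lintegral_swapKernel_le hp T θ hg) hf
  calc _ = (2 * (L : ℝ≥0∞)) * ((2 * (L : ℝ≥0∞))⁻¹ *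
      ∫⁻ θ, swapAccept p l θ * sqDist (f θ) (f (swapLevels l θ)) ∂μ) := by
        rw [← mul_assoc, ENNReal.mul_inv_cancel (by simp [hL]) (by finiteness), one_mul]
    _ ≤ (2 * ((L : ℝ≥0∞) + 1)) * (4 * energy (ptKernel p hp T) μ f) := by
        refine mul_le_mul' ?_ (h1.trans h2)
        gcongr
        exact le_self_add
    _ = _ := by ring

end Chain

/-! ### Overlap and bottleneck ratio -/

section Constants

variable {X : Type*} [MeasurableSpace X] {L : ℕ} {ν : Measure X} {p : Fin (L + 1) → X → ℝ≥0}
  [∀ i, IsProbabilityMeasure (level ν p i)] {m : ℕ} {A : Fin m → Set X}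

omit [∀ i, IsProbabilityMeasure (level ν p i)] in
lemma lintegral_min_le_level (i j : Fin (L + 1)) {s : Set X} (hs : MeasurableSet s) :
    ∫⁻ θ in s, (min (p i θ) (p j θ) : ℝ≥0) ∂ν ≤ level ν p i s := by
  rw [level, withDensity_apply _ hs]
  refine lintegral_mono fun θ => ?_
  exact ENNReal.coe_le_coe.2 (min_le_left _ _)

omit [∀ i, IsProbabilityMeasure (level ν p i)] in
/-- The overlap is `ENNReal.toReal` of a number in `[0, 1]`, hence not a junk value. -/
lemma exists_overlap (hL : 1 ≤ L) (hm : 0 < m) (hA : ∀ k, MeasurableSet (A k)) :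
    ∃ φ : ℝ≥0∞, φ ≤ 1 ∧ φ.toReal = overlap ν p A ∧
      ∀ i j : Fin (L + 1), (i : ℕ) + 1 = j ∨ (j : ℕ) + 1 = i → ∀ k,
        φ * level ν p i (A k) ≤ ∫⁻ θ in A k, (min (p i θ) (p j θ) : ℝ≥0) ∂ν := by
  have hle : ∀ i j : Fin (L + 1), (i : ℕ) + 1 = j ∨ (j : ℕ) + 1 = i → ∀ k,
      (⨅ (i : Fin (L + 1)) (j : Fin (L + 1)) (_ : (i : ℕ) + 1 = j ∨ (j : ℕ) + 1 = i) (k : Fin m),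
        (∫⁻ θ in A k, (min (p i θ) (p j θ) : ℝ≥0) ∂ν) / level ν p i (A k))
      ≤ (∫⁻ θ in A k, (min (p i θ) (p j θ) : ℝ≥0) ∂ν) / level ν p i (A k) :=
    fun i j hij k => iInf_le_of_le i <| iInf_le_of_le j <| iInf_le_of_le hij <| iInf_le _ k
  refine ⟨_, ?_, rfl, fun i j hij k => ?_⟩
  · refine (hle 0 ⟨1, by omega⟩ (by simp) ⟨0, hm⟩).trans ?_
    exact ENNReal.div_le_of_le_mul (by rw [one_mul]; exact lintegral_min_le_level _ _ (hA _))
  · exact ENNReal.mul_le_of_le_div (hle i j hij k)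

/-- Telescoping: along the ladder the masses decrease by at most the product of the ratios. -/
lemma prod_min_mul_le {a : Fin (L + 1) → ℝ≥0∞} {i j : Fin (L + 1)} (hij : i ≤ j) :
    (∏ l : Fin L, min 1 (a l.castSucc / a l.succ)) * a j ≤ a i := by
  set r : Fin L → ℝ≥0∞ := fun l => min 1 (a l.castSucc / a l.succ) with hr
  have hr1 : ∀ l, r l ≤ 1 := fun l => min_le_left _ _
  have hra : ∀ l, r l * a l.succ ≤ a l.castSucc := fun l =>
    ENNReal.mul_le_of_le_div (min_le_right _ _)
  have key : ∀ j : Fin (L + 1), ∀ i ≤ j,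
      (∏ l : Fin L with i ≤ l.castSucc ∧ l.castSucc < j, r l) * a j ≤ a i := by
    intro j
    induction j using Fin.induction with
    | zero =>
      intro i hi
      have : i = 0 := by simpa using hi
      subst this
      simp
    | succ l₀ ih =>
      intro i hi
      by_cases h : i = l₀.succ
      · subst h
        calc _ ≤ 1 * a l₀.succ := by
              gcongr
              exact Finset.prod_le_one' fun l _ => hr1 l
          _ = _ := one_mul _
      · have hi' : i ≤ l₀.castSucc := by
          rw [Fin.le_def] at hi ⊢
          have : (i : ℕ) ≠ l₀.succ := fun h' => h (Fin.ext h')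
          simp at hi this ⊢
          omega
        have hset : (Finset.univ.filter fun l : Fin L => i ≤ l.castSucc ∧ l.castSucc < l₀.succ)
            = insert l₀ (Finset.univ.filter fun l : Fin L =>
              i ≤ l.castSucc ∧ l.castSucc < l₀.castSucc) := by
          ext l
          simp only [Finset.mem_filter, Finset.mem_univ, true_and, Finset.mem_insert,
            Fin.le_def, Fin.lt_def, Fin.ext_iff] at hi' ⊢
          simp at hi' ⊢
          omega
        rw [hset, Finset.prod_insert (by simp)]
        calc _ = (∏ l : Fin L with i ≤ l.castSucc ∧ l.castSucc < l₀.castSucc, r l) *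
              (r l₀ * a l₀.succ) := by ring
          _ ≤ _ := by
              grw [hra l₀]
              exact ih i hi'
  refine le_trans (mul_le_mul' ?_ le_rfl) (key j i hij)
  exact Finset.prod_le_prod_of_subset_of_le_one' (Finset.subset_univ _) fun l _ _ => hr1 l

omit [∀ i, IsProbabilityMeasure (level ν p i)] in
lemma exists_bottleneck (hm : 0 < m) :
    ∃ b : ℝ≥0∞, b ≤ 1 ∧ b.toReal = bottleneck ν p A ∧
      ∀ i j, i ≤ j → ∀ k, b * level ν p j (A k) ≤ level ν p i (A k) := by
  have hle := fun k => iInf_le (fun k : Fin m => ∏ l : Fin L,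
    min 1 (level ν p l.castSucc (A k) / level ν p l.succ (A k))) k
  refine ⟨_, ?_, rfl, fun i j hij k => ?_⟩
  · exact (hle ⟨0, hm⟩).trans (Finset.prod_le_one' fun l _ => min_le_left _ _)
  · grw [hle k]
    exact prod_min_mul_le (a := fun i => level ν p i (A k)) hij

end Constants

/-- On a finite label space, domination of measures can be checked on the blocks. -/
lemma smul_map_le_map {X : Type*} [MeasurableSpace X] {m : ℕ} {lab : X → Fin m}
    (hlab : Measurable lab) {μ μ' : Measure X} {b : ℝ≥0∞}
    (h : ∀ k, b * μ (lab ⁻¹' {k}) ≤ μ' (lab ⁻¹' {k})) : b • μ.map lab ≤ μ'.map lab := by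
  refine Measure.le_intro fun s hs _ => ?_
  rw [Measure.smul_apply, smul_eq_mul, ← lintegral_indicator_one hs, ← lintegral_indicator_one hs,
    lintegral_fintype, lintegral_fintype, Finset.mul_sum]
  refine Finset.sum_le_sum fun k _ => ?_
  rw [Measure.map_apply hlab (measurableSet_singleton k),
    Measure.map_apply hlab (measurableSet_singleton k), mul_left_comm]
  gcongr
  exact h k

/-! ### The Poincaré inequality of the parallel tempering chain -/

section Main

variable {X : Type*} [MeasurableSpace X] {L : ℕ} {ν : Measure X} {p : Fin (L + 1) → X → ℝ≥0}
  [∀ i, IsProbabilityMeasure (level ν p i)] {m : ℕ} {lab : X → Fin m}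

/-- The Poincaré inequality from which the gap is read off. The overlap `φ`, the bottleneck ratio
`b`, the gaps `γ`, `δ` and the number `n` of halvings enter only through the inequalities they
satisfy. -/
lemma poincare_ptKernel (hp : ∀ i, Measurable (p i)) (T : Fin (L + 1) → Kernel X X)
    [∀ i, IsMarkovKernel (T i)] (hT : ∀ i, (T i).IsReversible (level ν p i))
    (hlab : Measurable lab) (h0 : ∀ i k, level ν p i (lab ⁻¹' {k}) ≠ 0)
    {φ b : ℝ≥0∞} (hφ1 : φ ≤ 1)
    (hφ : ∀ i j : Fin (L + 1), (i : ℕ) + 1 = j ∨ (j : ℕ) + 1 = i → ∀ k,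
        φ * level ν p i (lab ⁻¹' {k})
          ≤ ∫⁻ θ in lab ⁻¹' {k}, (min (p i θ) (p j θ) : ℝ≥0) ∂ν)
    (hb1 : b ≤ 1)
    (hb : ∀ i j, i ≤ j → ∀ k, b * level ν p j (lab ⁻¹' {k}) ≤ level ν p i (lab ⁻¹' {k}))
    {γ : ℝ} (hγ4 : γ ≤ 4)
    (hγ : ∀ i k, γ ≤ spectralGap
      (restrictTo (T i) (lab ⁻¹' {k}) (hlab (measurableSet_singleton k)))
      (condOn (level ν p i) (lab ⁻¹' {k})))
    {δ : ℝ} (hδ4 : δ ≤ 4)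
    (hδ : δ = spectralGap (projKernel (T 0) (level ν p 0) fun k => lab ⁻¹' {k})
      ((level ν p 0).map lab))
    {n : ℕ} (hn : L ≤ 2 ^ n)
    {f : (Fin (L + 1) → X) → ℝ} (hf : Measurable f) {M : ℝ} (hM : ∀ θ, |f θ| ≤ M) :
    ENNReal.ofReal γ * ENNReal.ofReal δ * φ ^ 2 * b ^ (n + 3) * spread (ptMeasure ν p) f
      ≤ 24000 * 9 ^ n * ((L : ℝ≥0∞) + 1) ^ 2 * energy (ptKernel p hp T) (ptMeasure ν p) f := by
  set g := ENNReal.ofReal γ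
  set d := ENNReal.ofReal δ
  set ε := energy (ptKernel p hp T) (ptMeasure ν p) f
  set K := (L : ℝ≥0∞) + 1 with hK
  have hg : g ≤ 4 := by
    calc g ≤ ENNReal.ofReal 4 := ENNReal.ofReal_le_ofReal hγ4
      _ = 4 := by simp
  have hd : d ≤ 4 := by
    calc d ≤ ENNReal.ofReal 4 := ENNReal.ofReal_le_ofReal hδ4
      _ = 4 := by simp
  have hφt : φ ≠ ∞ := (hφ1.trans_lt ENNReal.one_lt_top).ne
  have hbt : b ≠ ∞ := (hb1.trans_lt ENNReal.one_lt_top).ne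
  have hφ2 : φ ^ 2 ≤ 1 := pow_le_one' hφ1 2
  have hK1 : 1 ≤ K := le_add_self
  have h9 : (1 : ℝ≥0∞) ≤ 9 ^ n := one_le_pow₀ (by norm_num)
  let w : Fin (L + 1) → Measure (Fin m) := fun i => (level ν p i).map lab
  have hw : ∀ i, IsProbabilityMeasure (w i) := fun i =>
    Measure.isProbabilityMeasure_map hlab.aemeasurable
  have hbw : ∀ i j, i ≤ j → b • w j ≤ w i := fun i j hij => smul_map_le_map hlab (hb i j hij)
  let F := blockMean (level ν p) lab f
  have hF : Measurable F := Measurable.of_discrete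
  let e := fun i => ∫⁻ θ, ∫⁻ y, sqDist (f θ) (f (Function.update θ i y)) ∂(T i (θ i))
    ∂(ptMeasure ν p)
  have he : ∑ i, e i ≤ 8 * K * ε := sum_update_le_energy hp T _ hf
  have he0 : e 0 ≤ 8 * K * ε :=
    (Finset.single_le_sum (f := e) (fun _ _ => zero_le) (Finset.mem_univ 0)).trans he
  let N := ∫⁻ θ, sqDist (f θ) (F fun i => lab (θ i)) ∂(ptMeasure ν p)
  have hN : g * N ≤ 8 * K * ε := by
    refine (mul_le_mul' le_rfl (lintegral_sqDist_blockMean_le hlab h0 hf hM)).trans ?_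
    rw [Finset.mul_sum]
    exact (Finset.sum_le_sum fun i _ =>
      mul_lintegral_blockLaw_update_le hlab h0 (hT i) (hγ i) hf hM).trans he
  have hV0 : g * d * coordSpread w 0 F ≤ 144 * K * ε := by
    have h1 : d * coordSpread w 0 F ≤ 3 * (e 0 + 2 * N) := by
      have := mul_coordSpread_blockMean_le (i := 0) hlab h0 (hT 0).invariant hf F
      rw [← hδ] at this
      exact this
    calc g * d * coordSpread w 0 F = g * (d * coordSpread w 0 F) := by ring
      _ ≤ g * (3 * (e 0 + 2 * N)) := by gcongr
      _ = 3 * (g * e 0 + 2 * (g * N)) := by ring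
      _ ≤ 3 * (4 * (8 * K * ε) + 2 * (8 * K * ε)) := by gcongr
      _ = 144 * K * ε := by ring
  have hR : ∀ l : Fin L, g * φ ^ 2 * b * swapSpread w l.castSucc l.succ F ≤ 144 * K * ε := by
    intro l
    have h1 := mul_swapSpread_adjacent_le (w := w) hbt (hbw l.castSucc l.succ
      Fin.castSucc_lt_succ.le) hF
    have h2 := sq_mul_lintegral_swapLevels_le (l := l) hlab hp hφt
      (hφ l.castSucc l.succ (Or.inl (by simp))) (hφ l.succ l.castSucc (Or.inr (by simp))) hf F
    have h3 := swap_le_energy hp T (ptMeasure ν p) hf l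
    calc g * φ ^ 2 * b * swapSpread w l.castSucc l.succ F
        = g * (φ ^ 2 * (b * swapSpread w l.castSucc l.succ F)) := by ring
      _ ≤ g * (φ ^ 2 * ∫⁻ σ, sqDist (F σ) (F (swapLevels l σ)) ∂(Measure.pi w)) := by gcongr
      _ ≤ g * (3 * (8 * K * ε + 2 * N)) := by
          gcongr g * ?_
          refine h2.trans ?_
          gcongr
      _ = 3 * (g * (8 * K * ε) + 2 * (g * N)) := by ring
      _ ≤ 3 * (4 * (8 * K * ε) + 2 * (8 * K * ε)) := by gcongr
      _ = 144 * K * ε := by ring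
  let R := ⨆ l : Fin L, swapSpread w l.castSucc l.succ F
  have hRsup : g * φ ^ 2 * b * R ≤ 144 * K * ε := by
    rw [ENNReal.mul_iSup]
    exact iSup_le hR
  have hV : ∀ j, g * d * φ ^ 2 * b ^ (n + 3) * coordSpread w j F ≤ 7920 * 9 ^ n * K * ε := by
    intro j
    by_cases hj : j = 0
    · subst hj
      calc _ = φ ^ 2 * b ^ (n + 3) * (g * d * coordSpread w 0 F) := by ring
        _ ≤ 1 * 1 * (144 * K * ε) := by
            gcongr
            exact pow_le_one' hb1 _
        _ = 144 * 1 * K * ε := by ring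
        _ ≤ 7920 * 9 ^ n * K * ε := by
            gcongr
            norm_num
    · have hj0 : 0 < j := Fin.pos_of_ne_zero hj
      have h1 := sq_mul_coordSpread_le (w := w) (Ne.symm hj) hb1 (hbw 0 j hj0.le) hF
      have h2 := pow_mul_swapSpread_le (w := w) (M := R) hb1 hbw hF
        (fun l => le_iSup (fun l : Fin L => swapSpread w l.castSucc l.succ F) l) n 0 j hj0
        (by have := j.is_lt; simp; omega)
      calc _ = g * d * φ ^ 2 * b ^ (n + 1) * (b ^ 2 * coordSpread w j F) := by ring
        _ ≤ g * d * φ ^ 2 * b ^ (n + 1) *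
              (5 * (3 * coordSpread w 0 F + 2 * swapSpread w 0 j F)) := by gcongr
        _ = 15 * (φ ^ 2 * b ^ (n + 1) * (g * d * coordSpread w 0 F))
              + 10 * (d * (g * φ ^ 2 * b * (b ^ n * swapSpread w 0 j F))) := by ring
        _ ≤ 15 * (1 * 1 * (144 * K * ε)) + 10 * (4 * (g * φ ^ 2 * b * (9 ^ n * R))) := by
            gcongr
            exact pow_le_one' hb1 _
        _ = 15 * (144 * K * ε) + 40 * (9 ^ n * (g * φ ^ 2 * b * R)) := by ring
        _ ≤ 15 * (144 * K * ε) + 40 * (9 ^ n * (144 * K * ε)) := by gcongr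
        _ = 2160 * 1 * K * ε + 5760 * 9 ^ n * K * ε := by ring
        _ ≤ 2160 * 9 ^ n * K * ε + 5760 * 9 ^ n * K * ε := by gcongr
        _ = _ := by ring
  have hW : g * d * φ ^ 2 * b ^ (n + 3) * spread (Measure.pi w) F
      ≤ 7920 * 9 ^ n * K ^ 2 * ε := by
    calc _ ≤ g * d * φ ^ 2 * b ^ (n + 3) * ∑ j, coordSpread w j F := by
          gcongr
          exact spread_pi_le w hF
      _ ≤ ∑ _j : Fin (L + 1), 7920 * 9 ^ n * K * ε := by
          rw [Finset.mul_sum]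
          exact Finset.sum_le_sum fun j _ => hV j
      _ = 7920 * 9 ^ n * K ^ 2 * ε := by
          rw [Finset.sum_const, Finset.card_univ, Fintype.card_fin, nsmul_eq_mul, Nat.cast_add,
            Nat.cast_one, ← hK]
          ring
  have hspread : spread (ptMeasure ν p) f ≤ 3 * (2 * N + spread (Measure.pi w) F) := by
    let E : (Fin (L + 1) → X) → ℝ := fun θ => F fun i => lab (θ i)
    have hE : Measurable E := by fun_prop
    have h1 : spread (Measure.pi w) F
        = ∫⁻ θ, ∫⁻ η, sqDist (E θ) (E η) ∂(ptMeasure ν p) ∂(ptMeasure ν p) := by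
      unfold spread
      rw [lintegral_label_pi hlab]
      refine lintegral_congr fun θ => ?_
      rw [lintegral_label_pi hlab]
      rfl
    calc spread (ptMeasure ν p) f
        ≤ ∫⁻ θ, ∫⁻ η, 3 * (sqDist (f θ) (E θ) + sqDist (E θ) (E η) + sqDist (f η) (E η))
            ∂(ptMeasure ν p) ∂(ptMeasure ν p) := by
          refine lintegral_mono fun θ => lintegral_mono fun η => ?_
          rw [sqDist_comm (f η)]
          exact sqDist_triangle_three _ _ _ _
      _ = 3 * (N + spread (Measure.pi w) F + N) := by
          rw [h1]
          simp_rw [lintegral_const_mul' (3 : ℝ≥0∞) _ (by norm_num)]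
          congr 1
          have hη : ∀ θ, ∫⁻ η, (sqDist (f θ) (E θ) + sqDist (E θ) (E η) + sqDist (f η) (E η))
              ∂(ptMeasure ν p)
              = sqDist (f θ) (E θ) + ∫⁻ η, sqDist (E θ) (E η) ∂(ptMeasure ν p) + N := by
            intro θ
            rw [lintegral_add_left (by fun_prop), lintegral_add_left (by fun_prop), lintegral_const,
              measure_univ, mul_one]
          simp_rw [hη]
          rw [lintegral_add_left (by fun_prop), lintegral_add_left (by fun_prop), lintegral_const,
            measure_univ, mul_one]
      _ = _ := by ring
  calc g * d * φ ^ 2 * b ^ (n + 3) * spread (ptMeasure ν p) f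
      ≤ g * d * φ ^ 2 * b ^ (n + 3) * (3 * (2 * N + spread (Measure.pi w) F)) := by gcongr
    _ = 6 * (d * φ ^ 2 * b ^ (n + 3) * (g * N))
          + 3 * (g * d * φ ^ 2 * b ^ (n + 3) * spread (Measure.pi w) F) := by ring
    _ ≤ 6 * (4 * 1 * 1 * (8 * K * ε)) + 3 * (7920 * 9 ^ n * K ^ 2 * ε) := by
        gcongr
        exact pow_le_one' hb1 _
    _ = 192 * 1 * (K * 1) * ε + 23760 * 9 ^ n * K ^ 2 * ε := by ring
    _ ≤ 192 * 9 ^ n * (K * K) * ε + 23760 * 9 ^ n * K ^ 2 * ε := by gcongr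
    _ = 23952 * (9 ^ n * K ^ 2 * ε) := by ring
    _ ≤ 24000 * (9 ^ n * K ^ 2 * ε) := by gcongr; norm_num
    _ = _ := by ring

/-- The label map of a partition. -/
lemma exists_label {A : Fin m → Set X} (hA : ∀ k, MeasurableSet (A k))
    (hd : Pairwise fun k l => Disjoint (A k) (A l)) (hU : ⋃ k, A k = Set.univ) :
    ∃ lab : X → Fin m, Measurable lab ∧ A = fun k => lab ⁻¹' {k} := by
  have hex : ∀ x, ∃ k, x ∈ A k := fun x =>
    Set.mem_iUnion.1 (hU ▸ Set.mem_univ x)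
  choose lab hlab using hex
  have hA' : A = fun k => lab ⁻¹' {k} := by
    ext k x
    simp only [Set.mem_preimage, Set.mem_singleton_iff]
    constructor
    · intro hx
      by_contra hne
      exact Set.disjoint_left.1 (hd hne) (hlab x) hx
    · rintro rfl
      exact hlab x
  refine ⟨lab, measurable_to_countable' fun k => ?_, hA'⟩
  have := hA k
  rwa [hA'] at this

/-- The number `n` of halvings, which is `⌊log₂ L⌋ + 1`; the power of `9` is a power of `L` because
`9 = 2 ^ (2 log₂ 3)`. -/
lemma exists_halvings {L : ℕ} (hL : 1 ≤ L) :
    ∃ n : ℕ, L ≤ 2 ^ n ∧ (9 : ℝ) ^ n ≤ 9 * ((L : ℝ) + 1) ^ (2 * Real.logb 2 3) ∧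
      (n : ℝ) + 3 ≤ 5 / Real.log 2 * Real.log ((L : ℝ) + 1) := by
  have hlog2 : 0 < Real.log 2 := Real.log_pos (by norm_num)
  have hL' : (1 : ℝ) ≤ L := by exact_mod_cast hL
  have hk : (2 : ℝ) ^ Nat.log 2 L ≤ L + 1 := by
    have : 2 ^ Nat.log 2 L ≤ L := Nat.pow_log_le_self 2 (by omega)
    have : (2 : ℝ) ^ Nat.log 2 L ≤ L := by exact_mod_cast this
    linarith
  refine ⟨Nat.log 2 L + 1, (Nat.lt_pow_succ_log_self (by norm_num) L).le, ?_, ?_⟩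
  · have h9 : (9 : ℝ) = 2 ^ (2 * Real.logb 2 3) := by
      rw [mul_comm, Real.rpow_mul (by norm_num), Real.rpow_logb (by norm_num) (by norm_num)
        (by norm_num)]
      norm_num
    have hpos : 0 ≤ 2 * Real.logb 2 3 :=
      mul_nonneg (by norm_num) (Real.logb_nonneg (by norm_num) (by norm_num))
    rw [pow_succ, mul_comm]
    gcongr
    calc (9 : ℝ) ^ Nat.log 2 L = ((2 : ℝ) ^ Nat.log 2 L) ^ (2 * Real.logb 2 3) := by
          rw [← Real.rpow_natCast 2, ← Real.rpow_mul (by norm_num),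
            mul_comm (Nat.log 2 L : ℝ), Real.rpow_mul (by norm_num), ← h9, Real.rpow_natCast]
      _ ≤ _ := Real.rpow_le_rpow (by positivity) hk hpos
  · have h1 : (Nat.log 2 L : ℝ) * Real.log 2 ≤ Real.log ((L : ℝ) + 1) := by
      rw [← Real.log_pow]
      exact Real.log_le_log (by positivity) hk
    have h2 : Real.log 2 ≤ Real.log ((L : ℝ) + 1) :=
      Real.log_le_log (by norm_num) (by linarith)
    rw [div_mul_eq_mul_div, le_div_iff₀ hlog2]
    push_cast
    linarith

end Main

end ParallelTempering

end

open ParallelTempering in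
theorem theorem2 :
    ∃ C D : ℝ, 0 < C ∧ 0 < D ∧
      ∀ (X : Type*) [MeasurableSpace X] (ν : Measure X) (L : ℕ) (_ : 1 ≤ L)
        -- the densities of the levels `0, …, L`
        (p : Fin (L + 1) → X → ℝ≥0) (hp : ∀ i, Measurable (p i))
        [∀ i, IsProbabilityMeasure (level ν p i)]
        -- the transition kernels of the levels
        (T : Fin (L + 1) → Kernel X X) [∀ i, IsMarkovKernel (T i)]
        (_ : ∀ i, (T i).IsReversible (level ν p i))
        -- the partition
        (m : ℕ) (A : Fin m → Set X) (hA : ∀ k, MeasurableSet (A k))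
        (_ : Pairwise fun k l => Disjoint (A k) (A l)) (_ : ⋃ k, A k = Set.univ)
        (_ : ∀ i k, 0 < level ν p i (A k)),
        overlap ν p A ^ 2 * bottleneck ν p A ^ (C * Real.log ((L : ℝ) + 1)) /
              (D * (m : ℝ) ^ 3 * ((L : ℝ) + 1) ^ (3 + 2 * Real.logb 2 3)) *
            spectralGap (projKernel (T 0) (level ν p 0) A) (projMeasure (level ν p 0) A) *
            (⨅ (i : Fin (L + 1)) (k : Fin m),
              spectralGap (restrictTo (T i) (A k) (hA k)) (condOn (level ν p i) (A k))) ≤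
          spectralGap (ptKernel p hp T) (ptMeasure ν p) := by
  -- `C` bounds the `n + 3` factors of the bottleneck ratio, and `216000 = 9 * 24000`, as
  -- `9 ^ n ≤ 9 * (L + 1) ^ (2 log₂ 3)`.
  refine ⟨5 / Real.log 2, 216000, div_pos (by norm_num) (Real.log_pos (by norm_num)), by norm_num,
    ?_⟩
  intro X _ ν L hL p hp _ T _ hT m A hA hd hU hpos
  obtain ⟨lab, hlab, rfl⟩ := exists_label hA hd hU
  have h0 : ∀ i k, level ν p i (lab ⁻¹' {k}) ≠ 0 := fun i k => (hpos i k).ne'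
  have hX : Nonempty X := nonempty_of_isProbabilityMeasure (level ν p 0)
  have hm : 0 < m := (lab hX.some).pos
  obtain ⟨φ, hφ1, hφe, hφ⟩ := exists_overlap (ν := ν) (p := p) hL hm hA
  obtain ⟨b, hb1, hbe, hb⟩ := exists_bottleneck (ν := ν) (p := p) (A := fun k => lab ⁻¹' {k}) hm
  obtain ⟨n, hn, hn9, hnC⟩ := exists_halvings hL
  rw [projMeasure_eq_map hlab, ← hφe, ← hbe]
  have hinv : ∀ i, (T i).Invariant (level ν p i) := fun i => (hT i).invariant
  have hw := Measure.isProbabilityMeasure_map (μ := level ν p 0) hlab.aemeasurable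
  have hproj := isMarkovKernel_projKernel hlab (P := T 0) (h0 0)
  have hprojinv := invariant_projKernel hlab (hinv 0) (h0 0)
  have hcond : ∀ i k, IsProbabilityMeasure (condOn (level ν p i) (lab ⁻¹' {k})) := fun i k =>
    isProbabilityMeasure_condOn (hA k) (h0 i k)
  have hδ0 := spectralGap_nonneg hprojinv
  have hδ4 := spectralGap_le_four hprojinv
  set δ := spectralGap (projKernel (T 0) (level ν p 0) fun k => lab ⁻¹' {k})
    ((level ν p 0).map lab) with hδ
  set γ := ⨅ (i : Fin (L + 1)) (k : Fin m),
    spectralGap (restrictTo (T i) (lab ⁻¹' {k}) (hA k)) (condOn (level ν p i) (lab ⁻¹' {k}))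
  have hγ : ∀ i k, γ ≤ spectralGap (restrictTo (T i) (lab ⁻¹' {k}) (hA k))
      (condOn (level ν p i) (lab ⁻¹' {k})) := fun i k =>
    (ciInf_le (Set.finite_range _).bddBelow i).trans (ciInf_le (Set.finite_range _).bddBelow k)
  have hγ0 : 0 ≤ γ := Real.iInf_nonneg fun i => Real.iInf_nonneg fun k =>
    spectralGap_nonneg (invariant_restrictTo (hA k) (hT i))
  have hγ4 : γ ≤ 4 := (hγ 0 ⟨0, hm⟩).trans
    (spectralGap_le_four (invariant_restrictTo (hA _) (hT 0)))
  have hφt : φ ≠ ∞ := (hφ1.trans_lt ENNReal.one_lt_top).ne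
  have hbt : b ≠ ∞ := (hb1.trans_lt ENNReal.one_lt_top).ne
  have hφ1' : φ.toReal ≤ 1 := ENNReal.toReal_le_of_le_ofReal zero_le_one (by simpa using hφ1)
  have hb1' : b.toReal ≤ 1 := ENNReal.toReal_le_of_le_ofReal zero_le_one (by simpa using hb1)
  have hφ0 : 0 ≤ φ.toReal := ENNReal.toReal_nonneg
  have hb0 : 0 ≤ b.toReal := ENNReal.toReal_nonneg
  have hm1 : (1 : ℝ) ≤ (m : ℝ) ^ 3 := one_le_pow₀ (by exact_mod_cast hm)
  have hK : (1 : ℝ) ≤ (L : ℝ) + 1 := by simp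
  have hpow : b.toReal ^ (5 / Real.log 2 * Real.log ((L : ℝ) + 1)) ≤ b.toReal ^ (n + 3) := by
    rw [← Real.rpow_natCast]
    push_cast
    exact Real.rpow_le_rpow_of_exponent_ge' hb0 hb1' (by positivity) hnC
  have hden : 24000 * 9 ^ n * ((L : ℝ) + 1) ^ 2
      ≤ 216000 * (m : ℝ) ^ 3 * ((L : ℝ) + 1) ^ (3 + 2 * Real.logb 2 3) := by
    rw [Real.rpow_add (by linarith), show (3 : ℝ) = (3 : ℕ) by norm_num, Real.rpow_natCast]
    calc 24000 * 9 ^ n * ((L : ℝ) + 1) ^ 2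
        ≤ 24000 * (9 * ((L : ℝ) + 1) ^ (2 * Real.logb 2 3)) * ((L : ℝ) + 1) ^ 3 := by
          gcongr
          norm_num
      _ = 216000 * 1 * (((L : ℝ) + 1) ^ 3 * ((L : ℝ) + 1) ^ (2 * Real.logb 2 3)) := by ring
      _ ≤ _ := by
          push_cast
          gcongr
  have hden0 : (24000 : ℝ) ≤ 24000 * 9 ^ n * ((L : ℝ) + 1) ^ 2 := by
    have h1 : (1 : ℝ) ≤ 9 ^ n := one_le_pow₀ (by norm_num)
    have h2 : (1 : ℝ) ≤ ((L : ℝ) + 1) ^ 2 := one_le_pow₀ hK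
    nlinarith
  set D := 24000 * 9 ^ n * ((L : ℝ) + 1) ^ 2 with hD
  have hc : φ.toReal ^ 2 * b.toReal ^ (5 / Real.log 2 * Real.log ((L : ℝ) + 1)) /
        (216000 * (m : ℝ) ^ 3 * ((L : ℝ) + 1) ^ (3 + 2 * Real.logb 2 3)) * δ * γ
      ≤ φ.toReal ^ 2 * b.toReal ^ (n + 3) / D * δ * γ := by
    gcongr
  refine hc.trans (le_spectralGap (invariant_ptKernel hp T hinv) (by positivity) ?_ ?_)
  · calc φ.toReal ^ 2 * b.toReal ^ (n + 3) / D * δ * γ ≤ 1 ^ 2 * 1 ^ (n + 3) / 24000 * 4 * 4 := by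
          gcongr
      _ ≤ 1 := by norm_num
  · rintro f hf ⟨M, hM⟩
    have key := poincare_ptKernel hp T hT hlab h0 hφ1 hφ hb1 hb hγ4 hγ hδ4 hδ hn hf hM
    have hDe : (24000 * 9 ^ n * ((L : ℝ≥0∞) + 1) ^ 2) = ENNReal.ofReal D := by
      rw [hD, ENNReal.ofReal_mul (by positivity), ENNReal.ofReal_mul (by positivity),
        ENNReal.ofReal_pow (by positivity), ENNReal.ofReal_pow (by positivity),
        ENNReal.ofReal_add (by positivity) (by positivity)]
      simp
    have hD0 : 0 < D := by linarith
    have hce : ENNReal.ofReal (φ.toReal ^ 2 * b.toReal ^ (n + 3) / D * δ * γ)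
        = (ENNReal.ofReal D)⁻¹ * (ENNReal.ofReal γ * ENNReal.ofReal δ * φ ^ 2 * b ^ (n + 3)) := by
      rw [show φ.toReal ^ 2 * b.toReal ^ (n + 3) / D * δ * γ
          = D⁻¹ * (γ * δ * φ.toReal ^ 2 * b.toReal ^ (n + 3)) by ring,
        ENNReal.ofReal_mul (by positivity), ENNReal.ofReal_mul (by positivity),
        ENNReal.ofReal_mul (by positivity), ENNReal.ofReal_mul (by positivity),
        ENNReal.ofReal_inv_of_pos hD0, ENNReal.ofReal_pow hφ0, ENNReal.ofReal_pow hb0,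
        ENNReal.ofReal_toReal hφt, ENNReal.ofReal_toReal hbt]
    rw [hce, mul_assoc]
    rw [hDe] at key
    refine (mul_le_mul' le_rfl key).trans_eq ?_
    rw [← mul_assoc, ENNReal.inv_mul_cancel (by simpa using hD0) ENNReal.ofReal_ne_top, one_mul]
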